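/- Let $G=(V,E)$ be a finite undirected connected graph with $n$ nodes, parallel edges and loops allowed, in which every edge $e$ has a length $l(e)\in\mathbb{N}=\{0,1,2,\dots\}$ and a color $c(e)$. For an integer $k$ with $1\le k\le n-2$ and nodes $s,t\in V$, a $k$-interchange-constrained path from $s$ to $t$ is a path from $s$ to $t$ (no node repeated; the path without edges if $s=t$) whose sequence of edge colors has at most $k-1$ alternations, that is, at most $k-1$ pairs of consecutive edges of different colors. The $k$-interchange-constrained shortest path problem $\mathcal{PI}_k$ is solvable in polynomial time, uniformly in $k$: there are one algorithm (a random access machine program under the logarithmic cost criterion) and one polynomial $P$ such that, given any $G$ with its lengths and colors (colors and lengths being written as binary natural numbers) and any $k,s,t$ as above, the algorithm outputs a $k$-interchange-constrained path from $s$ to $t$ of minimum total length if such a path exists, and reports that there is none otherwise, at a cost of at most $P(N)$, where $N$ is the number of bits of the input. -/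

import Mathlib

/-! ## Random access machines with logarithmic cost -/

namespace RAM

/-- A memory state: registers, random access memory organised in banks (`bank b i` is cell `i` of
bank `b`), and the list of numbers written to the output so far. Registers and banks are
addressed by constants of the program, cells of a bank by the content of a register. -/
structure State where
  reg : ℕ → ℕ
  bank : ℕ → ℕ → ℕ
  out : List ℕ

/-- Elementary instructions. -/
inductive Instr where
  /-- `r := c` -/
  | const (r c : ℕ)
  /-- `r := x` -/
  | copy (r x : ℕ)
  /-- `r := x + y` -/
  | add (r x y : ℕ)
  /-- `r := x - y`, truncated at zero -/
  | sub (r x y : ℕ)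
  /-- `r := x * y` -/
  | mul (r x y : ℕ)
  /-- `r := b[x]` -/
  | load (r b x : ℕ)
  /-- `b[x] := y` -/
  | store (b x y : ℕ)
  /-- append `x` to the output -/
  | emit (x : ℕ)

/-- Assign a value to a register. -/
def State.setReg (σ : State) (r v : ℕ) : State :=
  { σ with reg := Function.update σ.reg r v }

/-- Effect of an elementary instruction. -/
def Instr.exec : Instr → State → State
  | .const r c, σ => σ.setReg r c
  | .copy r x, σ => σ.setReg r (σ.reg x)
  | .add r x y, σ => σ.setReg r (σ.reg x + σ.reg y)
  | .sub r x y, σ => σ.setReg r (σ.reg x - σ.reg y)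
  | .mul r x y, σ => σ.setReg r (σ.reg x * σ.reg y)
  | .load r b x, σ => σ.setReg r (σ.bank b (σ.reg x))
  | .store b x y, σ =>
      { σ with
        bank := Function.update σ.bank b (Function.update (σ.bank b) (σ.reg x) (σ.reg y)) }
  | .emit x, σ => { σ with out := σ.out ++ [σ.reg x] }

/-- Logarithmic cost of an elementary instruction: one unit, plus the number of binary digits of
every operand and of every computed address. -/
def Instr.cost : Instr → State → ℕ
  | .const _ c, _ => 1 + c.size
  | .copy _ x, σ => 1 + (σ.reg x).size
  | .add _ x y, σ => 1 + (σ.reg x).size + (σ.reg y).size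
  | .sub _ x y, σ => 1 + (σ.reg x).size + (σ.reg y).size
  | .mul _ x y, σ => 1 + (σ.reg x).size + (σ.reg y).size
  | .load _ b x, σ => 1 + (σ.reg x).size + (σ.bank b (σ.reg x)).size
  | .store _ x y, σ => 1 + (σ.reg x).size + (σ.reg y).size
  | .emit x, σ => 1 + (σ.reg x).size

/-- Programs. Control flow tests whether a register is nonzero. -/
inductive Prog where
  | skip
  | instr (i : Instr)
  | seq (p q : Prog)
  | ite (x : ℕ) (p q : Prog)
  | loop (x : ℕ) (p : Prog)

/-- `Run p σ c τ`: started in `σ`, the program `p` halts in `τ`, and the total cost is `c`. -/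
inductive Run : Prog → State → ℕ → State → Prop where
  | skip (σ : State) : Run .skip σ 1 σ
  | instr (i : Instr) (σ : State) : Run (.instr i) σ (i.cost σ) (i.exec σ)
  | seq {p q : Prog} {σ τ υ : State} {c d : ℕ} :
      Run p σ c τ → Run q τ d υ → Run (.seq p q) σ (c + d) υ
  | ite_pos {x : ℕ} {p q : Prog} {σ τ : State} {c : ℕ} :
      σ.reg x ≠ 0 → Run p σ c τ → Run (.ite x p q) σ (1 + (σ.reg x).size + c) τ
  | ite_zero {x : ℕ} {p q : Prog} {σ τ : State} {c : ℕ} :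
      σ.reg x = 0 → Run q σ c τ → Run (.ite x p q) σ (1 + (σ.reg x).size + c) τ
  | loop_pos {x : ℕ} {p : Prog} {σ τ υ : State} {c d : ℕ} :
      σ.reg x ≠ 0 → Run p σ c τ → Run (.loop x p) τ d υ →
        Run (.loop x p) σ (1 + (σ.reg x).size + c + d) υ
  | loop_zero {x : ℕ} {p : Prog} {σ : State} :
      σ.reg x = 0 → Run (.loop x p) σ (1 + (σ.reg x).size) σ

/-- The final state and the cost of a run are determined by the program and the initial state. -/
theorem Run.deterministic {p : Prog} {σ τ τ' : State} {c c' : ℕ}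
    (h : Run p σ c τ) (h' : Run p σ c' τ') : c = c' ∧ τ = τ' := by
  induction h generalizing c' τ' with
  | skip σ => cases h'; exact ⟨rfl, rfl⟩
  | instr i σ => cases h'; exact ⟨rfl, rfl⟩
  | seq _ _ ih₁ ih₂ =>
    cases h' with
    | seq h₁ h₂ =>
      obtain ⟨rfl, rfl⟩ := ih₁ h₁
      obtain ⟨rfl, rfl⟩ := ih₂ h₂
      exact ⟨rfl, rfl⟩
  | ite_pos hx _ ih =>
    cases h' with
    | ite_pos _ h₁ => obtain ⟨rfl, rfl⟩ := ih h₁; exact ⟨rfl, rfl⟩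
    | ite_zero h₀ _ => exact absurd h₀ hx
  | ite_zero hx _ ih =>
    cases h' with
    | ite_pos h₀ _ => exact absurd hx h₀
    | ite_zero _ h₁ => obtain ⟨rfl, rfl⟩ := ih h₁; exact ⟨rfl, rfl⟩
  | loop_pos hx _ _ ih₁ ih₂ =>
    cases h' with
    | loop_pos _ h₁ h₂ =>
      obtain ⟨rfl, rfl⟩ := ih₁ h₁
      obtain ⟨rfl, rfl⟩ := ih₂ h₂
      exact ⟨rfl, rfl⟩
    | loop_zero h₀ => exact absurd h₀ hx
  | loop_zero hx =>
    cases h' with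
    | loop_pos h₀ _ _ => exact absurd hx h₀
    | loop_zero _ => exact ⟨rfl, rfl⟩

/-- Initial state on input `w`: the input stands in bank `0`, its number of entries in register
`0`; everything else is zero and the output is empty. -/
def init (w : List ℕ) : State where
  reg := Function.update (fun _ => 0) 0 w.length
  bank := Function.update (fun _ _ => 0) 0 (fun i => w.getD i 0)
  out := []

/-- Size of an input in bits: every entry counts its binary digits and one separator. -/
def bitSize (w : List ℕ) : ℕ := (w.map fun a => a.size + 1).sum

/-- A search problem, given by its instances `a : α` (written as `encIn a`), candidate answers
`b : β a` (written as `encOut a b`) and the relation `Sol a b` ("`b` is a correct answer to `a`"),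
is solvable in polynomial time: one program, on every instance, halts with a correct answer as
its output, at a cost bounded by one polynomial in the bit size of the input. -/
def SolvableInPolyTime {α : Type} {β : α → Type} (encIn : α → List ℕ)
    (encOut : (a : α) → β a → List ℕ) (Sol : (a : α) → β a → Prop) : Prop :=
  ∃ (p : Prog) (P : Polynomial ℕ), ∀ a : α, ∃ (b : β a) (c : ℕ) (τ : State),
    Run p (init (encIn a)) c τ ∧ τ.out = encOut a b ∧ Sol a b ∧
      c ≤ P.eval (bitSize (encIn a))

end RAM

/-! ## Edge-colored graphs and interchange-constrained paths -/

/-- A finite undirected graph with nodes `0, …, n - 1` and edges `0, …, m - 1`, every edge having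
a length and a color. Parallel edges and loops are allowed; the order of the two ends `fst e`, `snd e` of an
edge carries no meaning. -/
structure ColoredGraph where
  n : ℕ
  m : ℕ
  fst : Fin m → Fin n
  snd : Fin m → Fin n
  len : Fin m → ℕ
  col : Fin m → ℕ

namespace ColoredGraph

variable (G : ColoredGraph)

/-- The edge `e` joins `x` and `y`. -/
def Links (e : Fin G.m) (x y : Fin G.n) : Prop :=
  (G.fst e = x ∧ G.snd e = y) ∨ (G.fst e = y ∧ G.snd e = x)

/-- A route from a given node: the successive edges, each with the node that it leads to. -/
abbrev Route : Type := List (Fin G.m × Fin G.n)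

/-- The route `p` is a walk from `x` to `y`. -/
def IsWalk : Fin G.n → G.Route → Fin G.n → Prop
  | x, [], y => x = y
  | x, (e, z) :: p, y => G.Links e x z ∧ IsWalk z p y

/-- The route `p` is a path from `x` to `y`: a walk that visits no node twice. -/
def IsPath (x : Fin G.n) (p : G.Route) (y : Fin G.n) : Prop :=
  G.IsWalk x p y ∧ (x :: p.map Prod.snd).Nodup

/-- Any two nodes are joined by a walk. -/
def Connected : Prop := ∀ x y : Fin G.n, ∃ p : G.Route, G.IsWalk x p y

/-- Total length of the edges of a route. -/
def routeLength (p : G.Route) : ℕ := (p.map fun a => G.len a.1).sum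

/-- The sequence of colors of the edges of a route. -/
def colors (p : G.Route) : List ℕ := p.map fun a => G.col a.1

/-- Number of alternations in a sequence of colors: of consecutive entries that differ. -/
def alternations : List ℕ → ℕ
  | a :: b :: l => (if a = b then 0 else 1) + alternations (b :: l)
  | _ => 0

/-- `p` is a `k`-interchange-constrained path from `s` to `t` (for `1 ≤ k`). -/
def IsInterchangeConstrained (k : ℕ) (s t : Fin G.n) (p : G.Route) : Prop :=
  G.IsPath s p t ∧ alternations (G.colors p) ≤ k - 1

end ColoredGraph

/-- Instances of the interchange-constrained shortest path problem; `k` is part of the input. -/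
structure PIInstance extends ColoredGraph where
  connected : toColoredGraph.Connected
  k : ℕ
  one_le_k : 1 ≤ k
  k_le : k + 2 ≤ n
  s : Fin n
  t : Fin n

namespace PIInstance

/-- The numbers `n, m, k, s, t`, followed by the list of edges: ends, length and color of each. -/
def encode (I : PIInstance) : List ℕ :=
  [I.n, I.m, I.k, (I.s : ℕ), (I.t : ℕ)] ++
    (List.finRange I.m).flatMap fun e => [(I.fst e : ℕ), (I.snd e : ℕ), I.len e, I.col e]

/-- An answer is a route, or `none` for "there is no feasible path". -/
abbrev Answer (I : PIInstance) : Type := Option I.Route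

/-- `0` for `none`; for a route `1`, followed by its edges and the nodes that they lead to. -/
def encodeAnswer (I : PIInstance) : I.Answer → List ℕ
  | none => [0]
  | some p => 1 :: p.flatMap fun a => [(a.1 : ℕ), (a.2 : ℕ)]

/-- The correct answers: a shortest `k`-interchange-constrained path from `s` to `t`, or `none`
if there is no such path. -/
def IsSolution (I : PIInstance) : I.Answer → Prop
  | none => ¬ ∃ q : I.Route, I.IsInterchangeConstrained I.k I.s I.t q
  | some p => I.IsInterchangeConstrained I.k I.s I.t p ∧
      ∀ q : I.Route, I.IsInterchangeConstrained I.k I.s I.t q → I.routeLength p ≤ I.routeLength q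

end PIInstance

/-! The algorithm is a dynamic program over arcs. Every edge becomes two opposite arcs, and an
additional start arc has `s` as its head. For each layer `L`, arc `a` and budget `j` one computes
the least weight of a walk of fewer than `L` arcs from the head of `a` to `t` with at most `j`
alternations, the one between `a` and the first arc included. Remembering the last arc instead of
the last node makes alternations local. The start arc has color 0 and all edge colors are shifted by
one, so leaving the start costs one alternation and the bound `k - 1` becomes `k`.

The recursion ranges over walks, yet its optimum is a path. An edge of length `l` weighs `l * (arcs
+ 1) + 1`, so walks of at most `arcs` edges are compared by length first and by number of edges
second. Cutting out a closed piece lowers this weight strictly, even if all lengths are zero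
(`weight_lt_of_sublist`), and creates no alternation (`alternations_cons_sublist`). A path has fewer
than `n ≤ m + 1` edges (`Connected.card_le`), so `arcs + 1` layers see every path.
`Represents.val_le` and `Represents.exists_walk` are the two halves of the correctness of the
recursion.

For the cost, each run gets a weight that bounds both the digits it adds to the numbers in memory
and, with their initial size, its logarithmic cost. Weights add up under sequencing, so loops are
handled by counting. The weight of `solver` is polynomial in the values of `m` and `k`; both are at
most the number of input entries, because `k + 2 ≤ n ≤ m + 1`. Lengths and colors matter only
through their digits. -/

namespace RAM

/-! ### A calculus of costs for machine programs. -/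

/-- Every register and every memory cell holds a number of at most `b` binary digits. -/
def State.Bounded (b : ℕ) (σ : State) : Prop :=
  (∀ r, (σ.reg r).size ≤ b) ∧ ∀ i j, (σ.bank i j).size ≤ b

theorem State.Bounded.mono {b b' : ℕ} {σ : State} (h : σ.Bounded b) (hb : b ≤ b') :
    σ.Bounded b' :=
  ⟨fun r => (h.1 r).trans hb, fun i j => (h.2 i j).trans hb⟩

theorem State.Bounded.setReg {b : ℕ} {σ : State} (h : σ.Bounded b) (r : ℕ) {v : ℕ}
    (hv : v.size ≤ b) : (σ.setReg r v).Bounded b := by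
  refine ⟨fun r' => ?_, h.2⟩
  simp only [State.setReg, Function.update_apply]
  split_ifs
  · exact hv
  · exact h.1 r'

/-- `p` leads from `σ` to `τ` with weight `w`: the weight bounds the growth of the numbers in
memory, and together with their initial size it bounds the cost. -/
def Reach (p : Prog) (σ : State) (w : ℕ) (τ : State) : Prop :=
  ∃ c, Run p σ c τ ∧ ∀ b, σ.Bounded b → τ.Bounded (b + w) ∧ c ≤ w * (1 + 2 * (b + w))

theorem Reach.mono {p : Prog} {σ τ : State} {w w' : ℕ} (h : Reach p σ w τ) (hw : w ≤ w') :
    Reach p σ w' τ := by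
  obtain ⟨c, hr, hc⟩ := h
  refine ⟨c, hr, fun b hb => ⟨(hc b hb).1.mono (by omega), (hc b hb).2.trans ?_⟩⟩
  gcongr

theorem Reach.skip (σ : State) : Reach .skip σ 1 σ :=
  ⟨1, .skip σ, fun b hb => ⟨hb.mono (by omega), by omega⟩⟩

theorem Reach.seq {p q : Prog} {σ τ υ : State} {w w' : ℕ} (h : Reach p σ w τ)
    (h' : Reach q τ w' υ) : Reach (.seq p q) σ (w + w') υ := by
  obtain ⟨c, hr, hc⟩ := h
  obtain ⟨c', hr', hc'⟩ := h'
  refine ⟨c + c', .seq hr hr', fun b hb => ?_⟩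
  obtain ⟨hb₁, h₁⟩ := hc b hb
  obtain ⟨hb₂, h₂⟩ := hc' _ hb₁
  refine ⟨hb₂.mono (by omega), ?_⟩
  calc c + c' ≤ w * (1 + 2 * (b + w)) + w' * (1 + 2 * (b + w + w')) := add_le_add h₁ h₂
    _ ≤ w * (1 + 2 * (b + (w + w'))) + w' * (1 + 2 * (b + (w + w'))) := by
      refine add_le_add (Nat.mul_le_mul_left _ ?_) (Nat.mul_le_mul_left _ ?_) <;> omega
    _ = _ := by ring

theorem branch_cost {b v c w : ℕ} (hv : v ≤ b) (hc : c ≤ w * (1 + 2 * (b + w))) :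
    1 + v + c ≤ (w + 1) * (1 + 2 * (b + (w + 1))) := by
  have : w * (1 + 2 * (b + w)) ≤ w * (1 + 2 * (b + (w + 1))) := by gcongr; omega
  rw [add_mul, one_mul]
  omega

theorem Reach.ite_pos {x : ℕ} {p q : Prog} {σ τ : State} {w : ℕ} (hx : σ.reg x ≠ 0)
    (h : Reach p σ w τ) : Reach (.ite x p q) σ (w + 1) τ := by
  obtain ⟨c, hr, hc⟩ := h
  exact ⟨_, .ite_pos hx hr, fun b hb =>
    ⟨(hc b hb).1.mono (by omega), branch_cost (hb.1 x) (hc b hb).2⟩⟩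

theorem Reach.ite_zero {x : ℕ} {p q : Prog} {σ τ : State} {w : ℕ} (hx : σ.reg x = 0)
    (h : Reach q σ w τ) : Reach (.ite x p q) σ (w + 1) τ := by
  obtain ⟨c, hr, hc⟩ := h
  exact ⟨_, .ite_zero hx hr, fun b hb =>
    ⟨(hc b hb).1.mono (by omega), branch_cost (hb.1 x) (hc b hb).2⟩⟩

theorem Reach.loop_zero {x : ℕ} {p : Prog} {σ : State} (hx : σ.reg x = 0) :
    Reach (.loop x p) σ 1 σ := by
  refine ⟨_, .loop_zero hx, fun b hb => ⟨hb.mono (by omega), ?_⟩⟩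
  have := hb.1 x
  omega

theorem Reach.loop_pos {x : ℕ} {p : Prog} {σ τ υ : State} {w w' : ℕ} (hx : σ.reg x ≠ 0)
    (h : Reach p σ w τ) (h' : Reach (.loop x p) τ w' υ) :
    Reach (.loop x p) σ (w + w' + 1) υ := by
  obtain ⟨c, hr, hc⟩ := h.seq h'
  cases hr with
  | seq hr hr' =>
    refine ⟨_, .loop_pos hx hr hr', fun b hb => ⟨(hc b hb).1.mono (by omega), ?_⟩⟩
    have := branch_cost (hb.1 x) (hc b hb).2
    omega

/-- Instructions after which the numbers in memory have at most four more digits. -/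
def Instr.plain : Instr → Bool
  | .const _ c => c < 8
  | .mul _ _ _ => false
  | _ => true

theorem size_add_le {x y b : ℕ} (hx : x.size ≤ b) (hy : y.size ≤ b) : (x + y).size ≤ b + 1 := by
  rw [Nat.size_le] at *
  rw [pow_succ]
  omega

theorem size_sub_le {x y b : ℕ} (hx : x.size ≤ b) : (x - y).size ≤ b :=
  (Nat.size_le_size (Nat.sub_le x y)).trans hx

theorem size_mul_le {x y b d : ℕ} (hx : x.size ≤ b) (hy : y ≤ d) : (x * y).size ≤ b + d := by
  rw [Nat.size_le] at *
  rw [pow_add]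
  exact Nat.mul_lt_mul'' hx (hy.trans_lt Nat.lt_two_pow_self)

theorem Reach.instr {i : Instr} (hi : i.plain = true) (σ : State) :
    Reach (.instr i) σ 4 (i.exec σ) := by
  refine ⟨_, .instr i σ, fun b hb => ?_⟩
  cases i with
  | const r c =>
    have hc : c.size ≤ 3 := by
      rw [Nat.size_le]
      simpa [Instr.plain] using hi
    refine ⟨(hb.mono (by omega)).setReg r (by omega), ?_⟩
    simp only [Instr.cost]
    omega
  | copy r x =>
    have := hb.1 x
    refine ⟨(hb.mono (by omega)).setReg r (by omega), ?_⟩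
    simp only [Instr.cost]
    omega
  | add r x y =>
    have hx := hb.1 x
    have hy := hb.1 y
    refine ⟨(hb.mono (by omega)).setReg r ((size_add_le hx hy).trans (by omega)), ?_⟩
    simp only [Instr.cost]
    omega
  | sub r x y =>
    have hx := hb.1 x
    have hy := hb.1 y
    refine ⟨(hb.mono (by omega)).setReg r ((size_sub_le hx).trans (by omega)), ?_⟩
    simp only [Instr.cost]
    omega
  | mul r x y => simp [Instr.plain] at hi
  | load r k x =>
    have hx := hb.1 x
    have hy := hb.2 k (σ.reg x)
    refine ⟨(hb.mono (by omega)).setReg r (hy.trans (by omega)), ?_⟩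
    simp only [Instr.cost]
    omega
  | store k x y =>
    have hx := hb.1 x
    have hy := hb.1 y
    refine ⟨⟨(hb.mono (by omega)).1, fun i j => ?_⟩, ?_⟩
    · have := hb.2 i j
      have := hb.2 k j
      simp only [Instr.exec, Function.update_apply]
      split_ifs
      · simp only [Function.update_apply]
        split_ifs <;> omega
      · omega
    · simp only [Instr.cost]
      omega
  | emit x =>
    have hx := hb.1 x
    refine ⟨⟨(hb.mono (by omega)).1, (hb.mono (by omega)).2⟩, ?_⟩
    simp only [Instr.cost]
    omega

/-- A product may double the number of digits, so a multiplication is charged the value of one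
factor. It is applied only with second factor `k + 1` or `arcs + 1`. -/
theorem Reach.mul {r x y d : ℕ} {σ : State} (hd : σ.reg y ≤ d) :
    Reach (.instr (.mul r x y)) σ (d + 1) (σ.setReg r (σ.reg x * σ.reg y)) := by
  refine ⟨_, .instr _ σ, fun b hb => ?_⟩
  have hx := hb.1 x
  have hy := hb.1 y
  refine ⟨(hb.mono (by omega)).setReg r ((size_mul_le hx hd).trans (by omega)), ?_⟩
  simp only [Instr.cost]
  rw [add_mul, one_mul]
  omega

/-- A sequence of instructions as a program. -/
def block : List Instr → Prog
  | [] => .skip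
  | i :: l => .seq (.instr i) (block l)

/-- Effect of a sequence of instructions. -/
def execs : List Instr → State → State
  | [], σ => σ
  | i :: l, σ => execs l (i.exec σ)

theorem Reach.block {l : List Instr} (hl : l.all Instr.plain = true) (σ : State) :
    Reach (block l) σ (4 * l.length + 1) (execs l σ) := by
  induction l generalizing σ with
  | nil => exact Reach.skip σ
  | cons i l ih =>
    simp only [List.all_cons, Bool.and_eq_true] at hl
    exact ((Reach.instr hl.1 σ).seq (ih hl.2 _)).mono (by simp only [List.length_cons]; omega)

/-- Started in `σ`, the program `p` halts with weight at most `w` in a state that satisfies `Q`. -/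
def Ends (p : Prog) (σ : State) (w : ℕ) (Q : State → Prop) : Prop :=
  ∃ τ, Reach p σ w τ ∧ Q τ

theorem Ends.mono {p : Prog} {σ : State} {w w' : ℕ} {Q Q' : State → Prop} (h : Ends p σ w Q)
    (hw : w ≤ w') (hQ : ∀ τ, Q τ → Q' τ) : Ends p σ w' Q' := by
  obtain ⟨τ, hr, hτ⟩ := h
  exact ⟨τ, hr.mono hw, hQ τ hτ⟩

theorem Ends.seq {p q : Prog} {σ : State} {w w' : ℕ} {Q Q' : State → Prop} (h : Ends p σ w Q)
    (h' : ∀ τ, Q τ → Ends q τ w' Q') : Ends (.seq p q) σ (w + w') Q' := by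
  obtain ⟨τ, hr, hτ⟩ := h
  obtain ⟨υ, hr', hυ⟩ := h' τ hτ
  exact ⟨υ, hr.seq hr', hυ⟩

theorem Ends.skip {σ : State} {Q : State → Prop} (h : Q σ) : Ends .skip σ 1 Q :=
  ⟨σ, Reach.skip σ, h⟩

theorem Ends.block {l : List Instr} {σ : State} {Q : State → Prop}
    (hl : l.all Instr.plain = true) (h : Q (execs l σ)) :
    Ends (block l) σ (4 * l.length + 1) Q :=
  ⟨_, Reach.block hl σ, h⟩

theorem Ends.mul {r x y d : ℕ} {σ : State} {Q : State → Prop} (hd : σ.reg y ≤ d)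
    (h : Q (σ.setReg r (σ.reg x * σ.reg y))) : Ends (.instr (.mul r x y)) σ (d + 1) Q :=
  ⟨_, Reach.mul hd, h⟩

theorem Ends.ite {x : ℕ} {p q : Prog} {σ : State} {w : ℕ} {Q : State → Prop}
    (h : σ.reg x ≠ 0 → Ends p σ w Q) (h' : σ.reg x = 0 → Ends q σ w Q) :
    Ends (.ite x p q) σ (w + 1) Q := by
  by_cases hx : σ.reg x = 0
  · obtain ⟨τ, hr, hτ⟩ := h' hx
    exact ⟨τ, hr.ite_zero hx, hτ⟩
  · obtain ⟨τ, hr, hτ⟩ := h hx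
    exact ⟨τ, hr.ite_pos hx, hτ⟩

/-- A loop whose condition register counts down from `n`. -/
theorem Ends.loop {x : ℕ} {p : Prog} {σ : State} {w n : ℕ} (Inv : ℕ → State → Prop)
    (count : ∀ i σ, i ≤ n → Inv i σ → σ.reg x = n - i)
    (step : ∀ i σ, i < n → Inv i σ → Ends p σ w (Inv (i + 1))) (start : Inv 0 σ) :
    Ends (.loop x p) σ ((w + 1) * n + 1) (Inv n) := by
  suffices h : ∀ r i σ, i + r = n → Inv i σ → Ends (.loop x p) σ ((w + 1) * r + 1) (Inv n) from
    h n 0 σ (by omega) start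
  intro r
  induction r with
  | zero =>
    intro i σ hi hσ
    have hx := count i σ (by omega) hσ
    obtain rfl : i = n := by omega
    exact ⟨σ, (Reach.loop_zero (by omega)).mono (by omega), hσ⟩
  | succ r ih =>
    intro i σ hi hσ
    have hx := count i σ (by omega) hσ
    obtain ⟨τ, hr, hτ⟩ := step i σ (by omega) hσ
    obtain ⟨υ, hr', hυ⟩ := ih (i + 1) τ (by omega) hτ
    exact ⟨υ, (Reach.loop_pos (by omega) hr hr').mono (by rw [mul_add]; omega), hυ⟩

end RAM

/-! ### The dynamic program and the layout of its tables. -/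

/-- A network of weighted colored arcs `0, …, arcs - 1`, and one more arc `arcs` that stands for
the start. -/
structure Net where
  arcs : ℕ
  target : ℕ
  tail : ℕ → ℕ
  head : ℕ → ℕ
  wt : ℕ → ℕ
  col : ℕ → ℕ
  edge : ℕ → ℕ

namespace Net

variable (N : Net)

/-- `1` if the arcs `a` and `b` differ in color, else `0`. -/
def turn (a b : ℕ) : ℕ := if N.col a = N.col b then 0 else 1

/-- Try to improve the current best pair of value and successor of `(a, j)` by the arc `b`. -/
def relax (v : ℕ → ℕ → ℕ) (a j : ℕ) (acc : ℕ × ℕ) (b : ℕ) : ℕ × ℕ :=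
  if N.tail b = N.head a ∧ N.turn a b ≤ j ∧ v b (j - N.turn a b) ≠ 0 ∧
      (acc.1 = 0 ∨ v b (j - N.turn a b) + N.wt b < acc.1)
  then (v b (j - N.turn a b) + N.wt b, b) else acc

/-- The best value and successor of `(a, j)` among the first arcs. -/
def scan (v : ℕ → ℕ → ℕ) (a j : ℕ) : ℕ → ℕ × ℕ
  | 0 => (0, 0)
  | b + 1 => N.relax v a j (scan v a j b) b

/-- One plus the least weight of a walk of fewer than `L` arcs that leads from the head of `a` to
the target with at most `j` alternations, counting one between `a` and the first arc; `0` if there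
is no such walk. -/
def val : ℕ → ℕ → ℕ → ℕ
  | 0, _, _ => 0
  | L + 1, a, j => if N.head a = N.target then 1 else (N.scan (val L) a j N.arcs).1

/-- The first arc of a best walk. -/
def succ : ℕ → ℕ → ℕ → ℕ
  | 0, _, _ => 0
  | L + 1, a, j => (N.scan (N.val L) a j N.arcs).2

/-- The edges and nodes of a best walk. -/
def trace : ℕ → ℕ → ℕ → List ℕ
  | 0, _, _ => []
  | L + 1, a, j =>
    if N.head a = N.target then [] else
      N.edge (N.succ (L + 1) a j) :: N.head (N.succ (L + 1) a j) ::
        trace L (N.succ (L + 1) a j) (j - N.turn a (N.succ (L + 1) a j))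

theorem trace_of_head_eq {L a : ℕ} (j : ℕ) (h : N.head a = N.target) : N.trace L a j = [] := by
  cases L <;> simp [trace, h]

/-- Even the default successor 0 addresses a row of the tables, so following successors never needs
a proof that a walk exists. -/
theorem scan_snd_le (v : ℕ → ℕ → ℕ) (a j n : ℕ) : (N.scan v a j n).2 ≤ n := by
  induction n with
  | zero => simp [scan]
  | succ n ih =>
    simp only [scan, relax]
    split_ifs
    · simp
    · exact ih.trans (Nat.le_succ n)

/-- The cell of the tables that belongs to `L`, `a`, `j`. -/
def cell (k L a j : ℕ) : ℕ := (L * (N.arcs + 1) + a) * (k + 1) + j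

/-- The table of values in the order of the cells. -/
def flatVal (k i : ℕ) : ℕ :=
  N.val (i / (k + 1) / (N.arcs + 1)) (i / (k + 1) % (N.arcs + 1)) (i % (k + 1))

/-- The table of successors in the order of the cells. -/
def flatSucc (k i : ℕ) : ℕ :=
  N.succ (i / (k + 1) / (N.arcs + 1)) (i / (k + 1) % (N.arcs + 1)) (i % (k + 1))

theorem cell_split {k L a j : ℕ} (ha : a ≤ N.arcs) (hj : j ≤ k) :
    N.cell k L a j / (k + 1) / (N.arcs + 1) = L ∧ N.cell k L a j / (k + 1) % (N.arcs + 1) = a ∧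
      N.cell k L a j % (k + 1) = j := by
  have h₁ : N.cell k L a j / (k + 1) = L * (N.arcs + 1) + a := by
    rw [cell, mul_comm, Nat.mul_add_div (by omega), Nat.div_eq_of_lt (by omega), add_zero]
  refine ⟨?_, ?_, ?_⟩
  · rw [h₁, mul_comm, Nat.mul_add_div (by omega), Nat.div_eq_of_lt (by omega), add_zero]
  · rw [h₁, mul_comm, Nat.mul_add_mod, Nat.mod_eq_of_lt (by omega)]
  · rw [cell, mul_comm, Nat.mul_add_mod, Nat.mod_eq_of_lt (by omega)]

theorem flatVal_cell {k L a j : ℕ} (ha : a ≤ N.arcs) (hj : j ≤ k) :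
    N.flatVal k (N.cell k L a j) = N.val L a j := by
  obtain ⟨h₁, h₂, h₃⟩ := N.cell_split (L := L) ha hj
  rw [flatVal, h₁, h₂, h₃]

theorem flatSucc_cell {k L a j : ℕ} (ha : a ≤ N.arcs) (hj : j ≤ k) :
    N.flatSucc k (N.cell k L a j) = N.succ L a j := by
  obtain ⟨h₁, h₂, h₃⟩ := N.cell_split (L := L) ha hj
  rw [flatSucc, h₁, h₂, h₃]

theorem cell_lt {k L M a j : ℕ} (ha : a ≤ N.arcs) (hj : j ≤ k) (h : L < M) :
    N.cell k L a j < M * ((N.arcs + 1) * (k + 1)) := by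
  calc N.cell k L a j < (L * (N.arcs + 1) + a + 1) * (k + 1) := by rw [cell, add_mul _ 1]; omega
    _ ≤ ((L + 1) * (N.arcs + 1)) * (k + 1) := by
      refine Nat.mul_le_mul_right _ ?_
      rw [add_mul]
      omega
    _ ≤ (M * (N.arcs + 1)) * (k + 1) := by gcongr; omega
    _ = _ := by ring

/-- Layer 0 vanishes like fresh memory, so the machine may start writing at layer 1. -/
theorem flat_of_lt {k i : ℕ} (h : i < (N.arcs + 1) * (k + 1)) :
    N.flatVal k i = 0 ∧ N.flatSucc k i = 0 := by
  have : i / (k + 1) / (N.arcs + 1) = 0 := by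
    rw [Nat.div_div_eq_div_mul, Nat.div_eq_of_lt (by rwa [mul_comm])]
  simp [flatVal, flatSucc, this, val, succ]

end Net

/-! ### Filling the tables on the machine. -/

namespace RAM

/-- Register 21 becomes nonzero if the arc in register 18 is no improvement, else register 24
becomes the improved value. -/
def tryArc : List Instr :=
  [.load 21 1 18, .sub 22 21 12, .sub 21 12 21, .add 21 21 22,
    .load 22 4 18, .sub 23 22 13, .sub 22 13 22, .add 22 22 23, .sub 22 1 22, .sub 22 1 22,
    .sub 23 22 14, .add 21 21 23,
    .add 23 19 14, .sub 23 23 22, .load 23 6 23,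
    .sub 24 1 23, .add 21 21 24,
    .load 24 3 18, .add 24 24 23,
    .add 23 24 1, .sub 23 23 16, .sub 23 1 23, .sub 23 1 23, .sub 25 1 16, .sub 23 23 25,
    .add 21 21 23]

def scanStep : Prog :=
  .seq (block tryArc) (.seq (.ite 21 .skip (block [.copy 16 24, .copy 17 18]))
    (block [.add 18 18 1, .add 19 19 4, .sub 20 20 1]))

/-- Compute one cell of the tables. -/
def cellStep : Prog :=
  .seq (block [.const 16 0, .const 17 0, .const 18 0, .copy 19 7, .copy 20 2])
    (.seq (.loop 20 scanStep)
      (.seq (block [.sub 21 12 5, .sub 22 5 12, .add 21 21 22])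
        (.seq (.ite 21 .skip (block [.const 16 1]))
          (block [.store 6 8 16, .store 7 8 17, .add 8 8 1, .add 14 14 1, .sub 15 15 1]))))

/-- Compute the cells of one arc. -/
def rowStep : Prog :=
  .seq (block [.load 12 2 10, .load 13 4 10, .const 14 0, .copy 15 4])
    (.seq (.loop 15 cellStep) (block [.add 10 10 1, .sub 11 11 1]))

/-- Compute one layer of the tables. -/
def layerStep : Prog :=
  .seq (block [.const 10 0, .copy 11 3])
    (.seq (.loop 11 rowStep) (block [.add 7 7 6, .sub 9 9 1]))

def fillTables : Prog :=
  .seq (block [.const 7 0, .copy 8 6, .copy 9 3]) (.loop 9 layerStep)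

/-- Registers and banks that hold the network. -/
structure Holds (N : Net) (k : ℕ) (σ : State) : Prop where
  one : σ.reg 1 = 1
  arcs : σ.reg 2 = N.arcs
  arcs_succ : σ.reg 3 = N.arcs + 1
  width : σ.reg 4 = k + 1
  target : σ.reg 5 = N.target
  layer : σ.reg 6 = (N.arcs + 1) * (k + 1)
  tail : σ.bank 1 = N.tail
  head : σ.bank 2 = N.head
  wt : σ.bank 3 = N.wt
  col : σ.bank 4 = N.col
  edge : σ.bank 5 = N.edge

/-- The first `p` cells of the tables are filled correctly. -/
def Filled (N : Net) (k p : ℕ) (σ : State) : Prop :=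
  ∀ i < p, σ.bank 6 i = N.flatVal k i ∧ σ.bank 7 i = N.flatSucc k i

/-- The invariants nest like the loops, and each level owns a range of registers: 7 and 9 for the
layer, 10 and 11 for the row, 12 to 15 for the cell, 16 to 20 for the scan; from 21 on there is
scratch space. Register 7 is the start of layer `L`, which is read; register 8 is the next position
to be written, in layer `L + 1`, and is left out of the outer invariants since every cell advances
it. -/
structure LayerInv (N : Net) (k L : ℕ) (σ : State) : Prop extends Holds N k σ where
  out : σ.out = []
  base : σ.reg 7 = L * ((N.arcs + 1) * (k + 1))
  layers : σ.reg 9 = N.arcs + 1 - L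

structure RowInv (N : Net) (k L a : ℕ) (σ : State) : Prop extends LayerInv N k L σ where
  arc : σ.reg 10 = a
  rows : σ.reg 11 = N.arcs + 1 - a

structure CellInv (N : Net) (k L a j : ℕ) (σ : State) : Prop extends RowInv N k L a σ where
  arcHead : σ.reg 12 = N.head a
  arcCol : σ.reg 13 = N.col a
  budget : σ.reg 14 = j
  cells : σ.reg 15 = k + 1 - j
  pos : σ.reg 8 = N.cell k (L + 1) a j
  filled : Filled N k (N.cell k (L + 1) a j) σ

structure ScanInv (N : Net) (k L a j b : ℕ) (σ : State) : Prop extends CellInv N k L a j σ where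
  best : σ.reg 16 = (N.scan (N.val L) a j b).1
  arg : σ.reg 17 = (N.scan (N.val L) a j b).2
  next : σ.reg 18 = b
  row : σ.reg 19 = (L * (N.arcs + 1) + b) * (k + 1)
  left : σ.reg 20 = N.arcs - b

theorem Holds.congr {N : Net} {k : ℕ} {σ τ : State} (h : Holds N k σ)
    (hr : ∀ r < 7, τ.reg r = σ.reg r) (hb : ∀ i < 6, τ.bank i = σ.bank i) : Holds N k τ where
  one := by rw [hr _ (by norm_num), h.one]
  arcs := by rw [hr _ (by norm_num), h.arcs]
  arcs_succ := by rw [hr _ (by norm_num), h.arcs_succ]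
  width := by rw [hr _ (by norm_num), h.width]
  target := by rw [hr _ (by norm_num), h.target]
  layer := by rw [hr _ (by norm_num), h.layer]
  tail := by rw [hb _ (by norm_num), h.tail]
  head := by rw [hb _ (by norm_num), h.head]
  wt := by rw [hb _ (by norm_num), h.wt]
  col := by rw [hb _ (by norm_num), h.col]
  edge := by rw [hb _ (by norm_num), h.edge]

theorem LayerInv.congr {N : Net} {k L : ℕ} {σ τ : State} (h : LayerInv N k L σ)
    (hr : ∀ r < 10, r ≠ 8 → τ.reg r = σ.reg r) (hb : ∀ i < 6, τ.bank i = σ.bank i)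
    (ho : τ.out = σ.out) : LayerInv N k L τ where
  toHolds := h.toHolds.congr (fun r h => hr r (by omega) (by omega)) hb
  out := by rw [ho, h.out]
  base := by rw [hr _ (by norm_num) (by norm_num), h.base]
  layers := by rw [hr _ (by norm_num) (by norm_num), h.layers]

theorem RowInv.congr {N : Net} {k L a : ℕ} {σ τ : State} (h : RowInv N k L a σ)
    (hr : ∀ r < 12, r ≠ 8 → τ.reg r = σ.reg r) (hb : ∀ i < 6, τ.bank i = σ.bank i)
    (ho : τ.out = σ.out) : RowInv N k L a τ where
  toLayerInv := h.toLayerInv.congr (fun r h => hr r (by omega)) hb ho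
  arc := by rw [hr _ (by norm_num) (by norm_num), h.arc]
  rows := by rw [hr _ (by norm_num) (by norm_num), h.rows]

theorem CellInv.congr {N : Net} {k L a j : ℕ} {σ τ : State} (h : CellInv N k L a j σ)
    (hr : ∀ r < 16, τ.reg r = σ.reg r) (hb : τ.bank = σ.bank) (ho : τ.out = σ.out) :
    CellInv N k L a j τ where
  toRowInv := h.toRowInv.congr (fun r h _ => hr r (by omega)) (fun i _ => by rw [hb]) ho
  arcHead := by rw [hr _ (by norm_num), h.arcHead]
  arcCol := by rw [hr _ (by norm_num), h.arcCol]
  budget := by rw [hr _ (by norm_num), h.budget]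
  cells := by rw [hr _ (by norm_num), h.cells]
  pos := by rw [hr _ (by norm_num), h.pos]
  filled := by rw [Filled, hb]; exact h.filled

theorem ScanInv.congr {N : Net} {k L a j b : ℕ} {σ τ : State} (h : ScanInv N k L a j b σ)
    (hr : ∀ r < 21, τ.reg r = σ.reg r) (hb : τ.bank = σ.bank) (ho : τ.out = σ.out) :
    ScanInv N k L a j b τ where
  toCellInv := h.toCellInv.congr (fun r h => hr r (by omega)) hb ho
  best := by rw [hr _ (by norm_num), h.best]
  arg := by rw [hr _ (by norm_num), h.arg]
  next := by rw [hr _ (by norm_num), h.next]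
  row := by rw [hr _ (by norm_num), h.row]
  left := by rw [hr _ (by norm_num), h.left]

/-- The instruction writes to no register below `n`, to no bank and not to the output. -/
def Instr.above (n : ℕ) : Instr → Bool
  | .const r _ | .copy r _ | .add r _ _ | .sub r _ _ | .mul r _ _ | .load r _ _ => n ≤ r
  | .store _ _ _ | .emit _ => false

/-- A frame rule with a decidable hypothesis: a block that writes only to inner registers preserves
the invariants of all outer loops. -/
theorem execs_above {n : ℕ} {l : List Instr} (hl : l.all (Instr.above n) = true) (σ : State) :
    (∀ r < n, (execs l σ).reg r = σ.reg r) ∧ (execs l σ).bank = σ.bank ∧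
      (execs l σ).out = σ.out := by
  induction l generalizing σ with
  | nil => exact ⟨fun _ _ => rfl, rfl, rfl⟩
  | cons i l ih =>
    simp only [List.all_cons, Bool.and_eq_true] at hl
    have key : ∀ {r v}, n ≤ r → ∀ r' < n, (σ.setReg r v).reg r' = σ.reg r' := by
      intro r v hr r' hr'
      exact Function.update_of_ne (by omega) _ _
    obtain ⟨h₁, h₂, h₃⟩ := ih hl.2 (i.exec σ)
    have hi := hl.1
    simp only [execs]
    cases i <;> simp only [Instr.above, decide_eq_true_eq, Bool.false_eq_true] at hi <;>
      exact ⟨fun r hr => (h₁ r hr).trans (key hi r hr), h₂, h₃⟩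

/-- Tests are done by truncated subtraction: `(x - y) + (y - x)` vanishes iff `x = y`, `x - y` iff
`x ≤ y`, and `1 - (1 - x)` is the indicator of `x ≠ 0`. Register 21 sums the failures of all
conditions, so it is zero iff all of them hold. -/
theorem tryArc_spec {N : Net} {k L a j b : ℕ} {σ : State} (h : ScanInv N k L a j b σ) :
    ((execs tryArc σ).reg 21 = 0 ↔ N.tail b = N.head a ∧ N.turn a b ≤ j ∧
        σ.bank 6 ((L * (N.arcs + 1) + b) * (k + 1) + j - N.turn a b) ≠ 0 ∧
        (σ.reg 16 = 0 ∨ σ.bank 6 ((L * (N.arcs + 1) + b) * (k + 1) + j - N.turn a b) + N.wt b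
          < σ.reg 16)) ∧
      (execs tryArc σ).reg 24 =
        σ.bank 6 ((L * (N.arcs + 1) + b) * (k + 1) + j - N.turn a b) + N.wt b := by
  have hturn : 1 - (1 - (N.col a - N.col b + (N.col b - N.col a))) = N.turn a b := by
    unfold Net.turn
    split_ifs <;> omega
  simp only [execs, tryArc, Instr.exec, State.setReg, Function.update_apply, Nat.reduceEqDiff,
    reduceIte, h.one, h.arcHead, h.arcCol, h.budget, h.next, h.row, h.tail, h.wt, h.col, hturn]
  generalize σ.bank 6 _ = v
  generalize N.turn a b = d
  generalize σ.reg 16 = x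
  refine ⟨?_, by omega⟩
  constructor
  · intro h
    refine ⟨?_, ?_, ?_, ?_⟩ <;> omega
  · rintro ⟨h₁, h₂, h₃, h₄⟩
    omega

theorem scanStep_ends {N : Net} {k L a j b : ℕ} (hj : j ≤ k) (hb : b < N.arcs)
    {σ : State} (h : ScanInv N k L a j b σ) :
    Ends scanStep σ 128 (ScanInv N k L a j (b + 1)) := by
  -- If the budget does not suffice, the address may point to an unrelated cell; this is harmless
  -- because the test has failed already.
  have hv : N.turn a b ≤ j → σ.bank 6 ((L * (N.arcs + 1) + b) * (k + 1) + j - N.turn a b) =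
      N.val L b (j - N.turn a b) := by
    intro ht
    -- The cell to be read lies in the preceding layer, hence among those already filled.
    have hlt : N.cell k L b (j - N.turn a b) < N.cell k (L + 1) a j := by
      have := N.cell_lt (k := k) (L := L) (a := b) (j := j - N.turn a b) hb.le (by omega)
        L.lt_add_one
      refine this.trans_le ?_
      rw [Net.cell, ← mul_assoc, add_mul _ a]
      omega
    rw [← N.flatVal_cell (L := L) hb.le (show j - N.turn a b ≤ k by omega),
      ← (h.filled _ hlt).1, Net.cell]
    congr 1
    omega
  have hscan : N.scan (N.val L) a j (b + 1) =
      if (execs tryArc σ).reg 21 = 0 then ((execs tryArc σ).reg 24, b)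
      else N.scan (N.val L) a j b := by
    obtain ⟨h₁, h₂⟩ := tryArc_spec h
    rw [h₂, Net.scan, Net.relax]
    by_cases ht : N.turn a b ≤ j
    · rw [hv ht, h.best] at h₁
      rw [hv ht]
      exact if_congr h₁.symm rfl rfl
    · rw [if_neg (fun h => ht h.2.1), if_neg (fun h => ht (h₁.1 h).2.1)]
  obtain ⟨hr, hb', ho⟩ := execs_above (n := 21) (l := tryArc) (by decide) σ
  have h' := h.congr hr hb' ho
  refine (Ends.seq (Q := (· = execs tryArc σ)) (Ends.block (by decide) rfl) ?_).mono
    (w := 105 + (10 + 13)) (by omega) (fun _ h => h)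
  rintro τ rfl
  refine Ends.seq (Q := fun τ => CellInv N k L a j τ ∧
    τ.reg 16 = (N.scan (N.val L) a j (b + 1)).1 ∧ τ.reg 17 = (N.scan (N.val L) a j (b + 1)).2 ∧
    τ.reg 18 = b ∧ τ.reg 19 = (L * (N.arcs + 1) + b) * (k + 1) ∧ τ.reg 20 = N.arcs - b)
    (Ends.ite (w := 9) (fun hx => (Ends.skip ?_).mono (by omega) (fun _ h => h))
      (fun hx => Ends.block (by decide) ?_)) ?_
  · rw [hscan, if_neg hx]
    exact ⟨h'.toCellInv, h'.best, h'.arg, h'.next, h'.row, h'.left⟩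
  · rw [hscan, if_pos hx]
    obtain ⟨hr, hb', ho⟩ := execs_above (n := 16) (l := [.copy 16 24, .copy 17 18]) (by decide)
      (execs tryArc σ)
    refine ⟨h'.toCellInv.congr hr hb' ho, ?_⟩
    generalize execs tryArc σ = τ at *
    simp [execs, Instr.exec, State.setReg, h'.next, h'.row, h'.left]
  · rintro τ ⟨hc, h₁, h₂, h₃, h₄, h₅⟩
    refine Ends.block (by decide) ?_
    obtain ⟨hr, hb', ho⟩ := execs_above (n := 16)
      (l := [.add 18 18 1, .add 19 19 4, .sub 20 20 1]) (by decide) τ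
    refine ⟨hc.congr hr hb' ho, ?_, ?_, ?_, ?_, ?_⟩ <;>
      simp [execs, Instr.exec, State.setReg, h₁, h₂, h₃, h₄, h₅, hc.one, hc.width]
    · ring
    · omega

theorem cellStep_ends {N : Net} {k L a j : ℕ} (ha : a ≤ N.arcs) (hj : j ≤ k) {σ : State}
    (h : CellInv N k L a j σ) :
    Ends cellStep σ (129 * N.arcs + 62) (CellInv N k L a (j + 1)) := by
  refine (Ends.seq (Q := ScanInv N k L a j 0) (Ends.block (by decide) ?_) fun τ hτ =>
    Ends.seq (Ends.loop (n := N.arcs) (ScanInv N k L a j) (fun i σ _ h => h.left)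
      (fun i σ hi h => scanStep_ends hj hi h) hτ) fun τ hτ => ?_).mono
    (w := 21 + ((129 * N.arcs + 1) + (13 + (6 + 21)))) (by omega) (fun _ h => h)
  · obtain ⟨hr, hb', ho⟩ := execs_above (n := 16)
      (l := [.const 16 0, .const 17 0, .const 18 0, .copy 19 7, .copy 20 2]) (by decide) σ
    refine ⟨h.congr hr hb' ho, ?_, ?_, ?_, ?_, ?_⟩ <;>
      simp [execs, Instr.exec, State.setReg, h.arcs, h.base, Net.scan]
    ring
  have hval : N.val (L + 1) a j = if N.head a = N.target then 1 else
      (N.scan (N.val L) a j N.arcs).1 := rfl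
  obtain ⟨hr, hb', ho⟩ := execs_above (n := 21)
    (l := [.sub 21 12 5, .sub 22 5 12, .add 21 21 22]) (by decide) τ
  have h' := hτ.congr hr hb' ho
  refine Ends.seq (Q := fun τ => ScanInv N k L a j N.arcs τ ∧
    (τ.reg 21 = 0 ↔ N.head a = N.target)) (Ends.block (by decide) ⟨h', ?_⟩) ?_
  · simp [execs, Instr.exec, State.setReg, hτ.arcHead, hτ.target]
    omega
  rintro τ ⟨hτ, hx⟩
  refine Ends.seq (Q := fun τ => CellInv N k L a j τ ∧ τ.reg 16 = N.val (L + 1) a j ∧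
    τ.reg 17 = N.succ (L + 1) a j)
    (Ends.ite (w := 5) (fun h => (Ends.skip ?_).mono (by omega) (fun _ h => h))
      (fun h => Ends.block (by decide) ?_)) ?_
  · rw [hval, if_neg (by rwa [← hx])]
    exact ⟨hτ.toCellInv, hτ.best, hτ.arg⟩
  · rw [hval, if_pos (hx.1 h)]
    obtain ⟨hr, hb', ho⟩ := execs_above (n := 16) (l := [.const 16 1]) (by decide) τ
    refine ⟨hτ.toCellInv.congr hr hb' ho, rfl, ?_⟩
    simp [execs, Instr.exec, State.setReg, hτ.arg, Net.succ]
  · rintro τ ⟨hτ, h₁, h₂⟩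
    refine Ends.block (by decide) ?_
    refine ⟨hτ.toRowInv.congr (τ := execs _ τ) ?_ ?_ ?_, ?_, ?_, ?_, ?_, ?_, ?_⟩
    · intro r hr hr'
      simp [execs, Instr.exec, State.setReg, show r ≠ 15 by omega, show r ≠ 14 by omega, hr']
    · intro i hi
      simp [execs, Instr.exec, State.setReg, show i ≠ 6 by omega, show i ≠ 7 by omega]
    · rfl
    · simp [execs, Instr.exec, State.setReg, hτ.arcHead]
    · simp [execs, Instr.exec, State.setReg, hτ.arcCol]
    · simp [execs, Instr.exec, State.setReg, hτ.one, hτ.budget]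
    · simp [execs, Instr.exec, State.setReg, hτ.one, hτ.cells]
      omega
    · simp [execs, Instr.exec, State.setReg, hτ.one, hτ.pos, Net.cell, add_assoc]
    · intro i hi
      have hi' : i < N.cell k (L + 1) a j ∨ i = N.cell k (L + 1) a j := by
        simp only [Net.cell] at hi ⊢
        omega
      rcases hi' with hi' | rfl
      · simpa [execs, Instr.exec, State.setReg, hτ.pos, Function.update_apply, hi'.ne]
          using hτ.filled i hi'
      · rw [N.flatVal_cell ha hj, N.flatSucc_cell ha hj]
        simp [execs, Instr.exec, State.setReg, hτ.pos, h₁, h₂]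

/-- All rows before row `a` of layer `L + 1` are filled. -/
structure RowsFilled (N : Net) (k L a : ℕ) (σ : State) : Prop extends RowInv N k L a σ where
  pos : σ.reg 8 = N.cell k (L + 1) a 0
  filled : Filled N k (N.cell k (L + 1) a 0) σ

/-- All layers up to layer `L` are filled. -/
structure LayersFilled (N : Net) (k L : ℕ) (σ : State) : Prop extends LayerInv N k L σ where
  pos : σ.reg 8 = N.cell k (L + 1) 0 0
  filled : Filled N k (N.cell k (L + 1) 0 0) σ

theorem rowStep_ends {N : Net} {k L a : ℕ} (ha : a ≤ N.arcs) {σ : State}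
    (h : RowsFilled N k L a σ) :
    Ends rowStep σ ((129 * N.arcs + 63) * (k + 1) + 27) (RowsFilled N k L (a + 1)) := by
  refine (Ends.seq (Q := CellInv N k L a 0) (Ends.block (by decide) ?_) fun τ hτ =>
    Ends.seq (Ends.loop (n := k + 1) (CellInv N k L a) (fun i σ _ h => h.cells)
      (fun i σ hi h => cellStep_ends ha (by omega) h) hτ) fun τ hτ =>
      Ends.block (by decide) ?_).mono
    (w := 17 + (((129 * N.arcs + 62 + 1) * (k + 1) + 1) + 9)) (le_of_eq (by ring)) (fun _ h => h)
  · obtain ⟨hr, hb', ho⟩ := execs_above (n := 12)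
      (l := [.load 12 2 10, .load 13 4 10, .const 14 0, .copy 15 4]) (by decide) σ
    refine ⟨h.toRowInv.congr (fun r h _ => hr r h) (fun i _ => by rw [hb']) ho, ?_, ?_, ?_, ?_, ?_, ?_⟩
    · simp [execs, Instr.exec, State.setReg, h.arc, h.head]
    · simp [execs, Instr.exec, State.setReg, h.arc, h.col]
    · simp [execs, Instr.exec, State.setReg]
    · simp [execs, Instr.exec, State.setReg, h.width]
    · rw [hr _ (by norm_num), h.pos]
    · exact h.filled
  -- A row has `k + 1` cells, so the position after its last cell is the start of the next row.
  · have hcell : N.cell k (L + 1) a (k + 1) = N.cell k (L + 1) (a + 1) 0 := by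
      simp only [Net.cell]
      ring
    obtain ⟨hr, hb', ho⟩ := execs_above (n := 10)
      (l := [.add 10 10 1, .sub 11 11 1]) (by decide) τ
    refine ⟨⟨hτ.toLayerInv.congr (fun r h _ => hr r h) (fun i _ => by rw [hb']) ho, ?_, ?_⟩, ?_, ?_⟩
    · simp [execs, Instr.exec, State.setReg, hτ.arc, hτ.one]
    · simp [execs, Instr.exec, State.setReg, hτ.rows, hτ.one]
      omega
    · rw [hr _ (by norm_num), hτ.pos, hcell]
    · rw [← hcell]
      exact hτ.filled

theorem layerStep_ends {N : Net} {k L : ℕ} {σ : State} (h : LayersFilled N k L σ) :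
    Ends layerStep σ (((129 * N.arcs + 63) * (k + 1) + 28) * (N.arcs + 1) + 19)
      (LayersFilled N k (L + 1)) := by
  refine (Ends.seq (Q := RowsFilled N k L 0) (Ends.block (by decide) ?_) fun τ hτ =>
    Ends.seq (Ends.loop (n := N.arcs + 1) (RowsFilled N k L) (fun i σ _ h => h.rows)
      (fun i σ hi h => rowStep_ends (by omega) h) hτ) fun τ hτ =>
      Ends.block (by decide) ?_).mono
    (w := 9 + (((((129 * N.arcs + 63) * (k + 1) + 27) + 1) * (N.arcs + 1) + 1) + 9))
    (le_of_eq (by ring)) (fun _ h => h)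
  · obtain ⟨hr, hb', ho⟩ := execs_above (n := 10)
      (l := [.const 10 0, .copy 11 3]) (by decide) σ
    refine ⟨⟨h.toLayerInv.congr (fun r h _ => hr r h) (fun i _ => by rw [hb']) ho, ?_, ?_⟩, ?_, ?_⟩
    · simp [execs, Instr.exec, State.setReg]
    · simp [execs, Instr.exec, State.setReg, h.arcs_succ]
    · rw [hr _ (by norm_num), h.pos]
    · exact h.filled
  · have hcell : N.cell k (L + 1) (N.arcs + 1) 0 = N.cell k (L + 1 + 1) 0 0 := by
      simp only [Net.cell]
      ring
    refine ⟨⟨hτ.toHolds.congr (τ := execs _ τ) ?_ ?_, ?_, ?_, ?_⟩, ?_, ?_⟩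
    · intro r hr
      simp [execs, Instr.exec, State.setReg, show r ≠ 7 by omega, show r ≠ 9 by omega]
    · intro i _
      rfl
    · exact hτ.out
    · simp [execs, Instr.exec, State.setReg, hτ.base, hτ.layer]
      ring
    · simp [execs, Instr.exec, State.setReg, hτ.layers, hτ.one]
      omega
    · simp [execs, Instr.exec, State.setReg, hτ.pos, ← hcell]
    · rw [← hcell]
      exact hτ.filled

theorem fillTables_ends {N : Net} {k : ℕ} {σ : State} (h : Holds N k σ) (ho : σ.out = [])
    (h₆ : σ.bank 6 = fun _ => 0) (h₇ : σ.bank 7 = fun _ => 0) :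
    Ends fillTables σ
      ((((129 * N.arcs + 63) * (k + 1) + 28) * (N.arcs + 1) + 20) * (N.arcs + 1) + 14)
      (LayersFilled N k (N.arcs + 1)) := by
  have hloop (τ : State) (hτ : LayersFilled N k 0 τ) :=
    Ends.loop (n := N.arcs + 1) (LayersFilled N k) (fun i σ _ h => h.layers)
      (fun i σ hi h => layerStep_ends h) hτ
  suffices h : LayersFilled N k 0 (execs [.const 7 0, .copy 8 6, .copy 9 3] σ) from
    ((Ends.block (by decide) h).seq hloop).mono
      (le_of_eq (by simp only [List.length_cons, List.length_nil]; ring)) (fun _ h => h)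
  obtain ⟨hr, hb', ho'⟩ := execs_above (n := 7)
    (l := [.const 7 0, .copy 8 6, .copy 9 3]) (by decide) σ
  refine ⟨⟨h.congr hr (fun i _ => by rw [hb']), ?_, ?_, ?_⟩, ?_, ?_⟩
  · rw [ho', ho]
  · simp [execs, Instr.exec, State.setReg]
  · simp [execs, Instr.exec, State.setReg, h.arcs_succ]
  · simp [execs, Instr.exec, State.setReg, h.layer, Net.cell]
  · intro i hi
    obtain ⟨h₁, h₂⟩ := N.flat_of_lt (k := k) (i := i) (by simpa [Net.cell] using hi)
    rw [hb', h₁, h₂, h₆, h₇]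
    exact ⟨rfl, rfl⟩

end RAM

/-! ### Reading an optimal walk off the tables. -/

namespace RAM

/-- Output the next edge and node, and move on to the next cell. -/
def followArc : Prog :=
  .seq (block [.load 18 7 21, .load 23 5 18, .emit 23, .load 24 2 18, .emit 24,
      .load 23 4 18, .load 24 4 10, .sub 25 24 23, .sub 24 23 24, .add 24 25 24, .sub 24 1 24,
      .sub 24 1 24, .sub 14 14 24, .sub 7 7 6])
    (.seq (.instr (.mul 21 18 4)) (block [.add 21 21 7, .add 21 21 14, .copy 10 18]))

def outputStep : Prog :=
  .seq (block [.load 12 2 10, .sub 22 12 5, .sub 23 5 12, .add 22 22 23])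
    (.seq (.ite 22 followArc .skip) (block [.sub 9 9 1]))

/-- Output the result, given the filled tables. -/
def output : Prog :=
  .seq (block [.sub 21 8 1, .load 22 6 21])
    (.ite 22
      (.seq (block [.emit 1, .copy 10 2, .sub 14 4 1, .copy 9 3]) (.loop 9 outputStep))
      (block [.emit 22]))

/-- The tables are filled, and the output and the remaining walk make up `l`. -/
structure OutputInv (N : Net) (k : ℕ) (l : List ℕ) (i : ℕ) (σ : State) : Prop
    extends Holds N k σ where
  filled : Filled N k ((N.arcs + 2) * ((N.arcs + 1) * (k + 1))) σ
  rest : ∃ a j, σ.reg 10 = a ∧ σ.reg 14 = j ∧ a ≤ N.arcs ∧ j ≤ k ∧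
    σ.out ++ N.trace (N.arcs + 1 - i) a j = l ∧
    (N.head a ≠ N.target → σ.reg 7 = (N.arcs + 1 - i) * ((N.arcs + 1) * (k + 1)) ∧
      σ.reg 21 = N.cell k (N.arcs + 1 - i) a j)
  left : σ.reg 9 = N.arcs + 1 - i

theorem outputStep_ends {N : Net} {k i : ℕ} {l : List ℕ} (hi : i < N.arcs + 1) {σ : State}
    (h : OutputInv N k l i σ) :
    Ends outputStep σ (k + 106) (OutputInv N k l (i + 1)) := by
  obtain ⟨a, j, ha, hj, hale, hjle, hout, hpos⟩ := h.rest
  obtain ⟨L, hL⟩ : ∃ L, N.arcs + 1 - i = L + 1 := ⟨N.arcs - i, by omega⟩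
  have hL' : N.arcs + 1 - (i + 1) = L := by omega
  rw [hL] at hout hpos
  obtain ⟨hr, hb', ho⟩ := execs_above (n := 12)
    (l := [.load 12 2 10, .sub 22 12 5, .sub 23 5 12, .add 22 22 23]) (by decide) σ
  refine (Ends.seq (Q := fun τ => Holds N k τ ∧ τ.bank = σ.bank ∧ τ.out = σ.out ∧
    τ.reg 10 = a ∧ τ.reg 14 = j ∧ τ.reg 7 = σ.reg 7 ∧ τ.reg 21 = σ.reg 21 ∧ τ.reg 9 = L + 1 ∧
    (τ.reg 22 = 0 ↔ N.head a = N.target)) (Ends.block (by decide) ?_) ?_).mono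
    (w := 17 + ((57 + (k + 1 + 1 + 13) + 1) + 5)) (by omega) (fun _ h => h)
  · refine ⟨h.toHolds.congr (fun r h => hr r (by omega)) (fun i _ => by rw [hb']), hb', ho, ?_⟩
    simp [execs, Instr.exec, State.setReg, ha, hj, h.head, h.target, h.left, hL]
    omega
  rintro τ ⟨hH, hbank, hout', h10, h14, h7, h21, h9, h22⟩
  refine Ends.seq (Q := fun τ => Holds N k τ ∧
    Filled N k ((N.arcs + 2) * ((N.arcs + 1) * (k + 1))) τ ∧ (∃ a j, τ.reg 10 = a ∧
    τ.reg 14 = j ∧ a ≤ N.arcs ∧ j ≤ k ∧ τ.out ++ N.trace L a j = l ∧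
    (N.head a ≠ N.target → τ.reg 7 = L * ((N.arcs + 1) * (k + 1)) ∧
      τ.reg 21 = N.cell k L a j)) ∧ τ.reg 9 = L + 1)
    (Ends.ite (fun hx => ?_) fun hx => (Ends.skip ?_).mono (by omega) (fun _ h => h)) ?_
  · have hne : N.head a ≠ N.target := by rwa [Ne, ← h22]
    obtain ⟨p₁, p₂⟩ := hpos hne
    have hsucc : σ.bank 7 (N.cell k (L + 1) a j) = N.succ (L + 1) a j := by
      rw [(h.filled _ (N.cell_lt hale hjle (by omega))).2, N.flatSucc_cell hale hjle]
    obtain ⟨b, hb⟩ : ∃ b, N.succ (L + 1) a j = b := ⟨_, rfl⟩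
    have hble : b ≤ N.arcs := by
      rw [← hb]
      exact N.scan_snd_le _ _ _ _
    have hturn : 1 - (1 - (N.col a - N.col b + (N.col b - N.col a))) = N.turn a b := by
      unfold Net.turn
      split_ifs <;> omega
    have hsub : (L + 1) * ((N.arcs + 1) * (k + 1)) - (N.arcs + 1) * (k + 1) =
        L * ((N.arcs + 1) * (k + 1)) := by
      rw [add_mul L, one_mul, Nat.add_sub_cancel]
    rw [Net.trace, if_neg hne, hb] at hout
    refine Ends.seq (Q := fun τ => Holds N k τ ∧ τ.bank = σ.bank ∧
      τ.out = σ.out ++ [N.edge b, N.head b] ∧ τ.reg 14 = j - N.turn a b ∧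
      τ.reg 7 = L * ((N.arcs + 1) * (k + 1)) ∧ τ.reg 18 = b ∧ τ.reg 9 = L + 1)
      (Ends.block (by decide) ?_) ?_
    · refine ⟨hH.congr ?_ ?_, ?_⟩
      · intro r hr
        simp [execs, Instr.exec, State.setReg, show r ≠ 7 by omega,
          show r ≠ 14 by omega, show r ≠ 18 by omega, show r ≠ 23 by omega,
          show r ≠ 24 by omega, show r ≠ 25 by omega]
      · intro i _
        rfl
      · simp [execs, Instr.exec, State.setReg, h7, h10, h14, h21, h9, p₁, p₂, hH.layer, hH.one,
          h.col, h.edge, h.head, hbank, hout', hsucc, hb, hturn, hsub]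
    rintro τ ⟨hH, hbank, hout', h14, h7, h18, h9⟩
    refine Ends.seq (Q := fun τ => Holds N k τ ∧ τ.bank = σ.bank ∧
      τ.out = σ.out ++ [N.edge b, N.head b] ∧ τ.reg 14 = j - N.turn a b ∧
      τ.reg 7 = L * ((N.arcs + 1) * (k + 1)) ∧ τ.reg 18 = b ∧ τ.reg 9 = L + 1 ∧
      τ.reg 21 = b * (k + 1)) (Ends.mul hH.width.le ?_) ?_
    · refine ⟨hH.congr ?_ (fun _ _ => rfl), ?_⟩
      · intro r hr
        simp [State.setReg, show r ≠ 21 by omega]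
      · simp [State.setReg, hbank, hout', h14, h7, h18, h9, hH.width]
    rintro τ ⟨hH, hbank, hout', h14, h7, h18, h9, h21⟩
    refine Ends.block (by decide) ⟨hH.congr ?_ (fun _ _ => rfl), ?_, ⟨b, j - N.turn a b, ?_⟩, ?_⟩
    · intro r hr
      simp [execs, Instr.exec, State.setReg, show r ≠ 21 by omega,
        show r ≠ 10 by omega]
    · intro i hi
      change τ.bank 6 i = _ ∧ τ.bank 7 i = _
      rw [hbank]
      exact h.filled i hi
    · simp [execs, Instr.exec, State.setReg, h14, h7, h18, h21, hout', hble,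
        (Nat.sub_le _ _).trans hjle, hout, Net.cell]
      intro _
      ring
    · simp [execs, Instr.exec, State.setReg, h9]
  -- At the target the walk stands still while the counter runs on. Registers 7 and 21 then lag
  -- behind, which is why the invariant constrains them only away from the target.
  · have hx := h22.1 hx
    refine ⟨hH, by rw [Filled, hbank]; exact h.filled, ⟨a, j, h10, h14, hale, hjle, ?_,
      fun hne => absurd hx hne⟩, h9⟩
    rw [N.trace_of_head_eq j hx] at hout ⊢
    rw [hout', hout]
  · rintro τ ⟨hH, hf, ⟨a, j, h10, h14, hale, hjle, hrest⟩, h9⟩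
    rw [← hL'] at hrest
    refine Ends.block (by decide) ⟨hH.congr ?_ (fun _ _ => rfl), hf, ⟨a, j, ?_⟩, ?_⟩
    · intro r hr
      simp [execs, Instr.exec, State.setReg, show r ≠ 9 by omega]
    · simpa [execs, Instr.exec, State.setReg, h10, h14, hale, hjle] using hrest
    · simp [execs, Instr.exec, State.setReg, h9, hH.one, hL']

theorem output_ends {N : Net} {k : ℕ} {σ : State} (h : LayersFilled N k (N.arcs + 1) σ) :
    Ends output σ ((k + 107) * (N.arcs + 1) + 28) (fun τ => τ.out =
      if N.val (N.arcs + 1) N.arcs k = 0 then [0]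
      else 1 :: N.trace (N.arcs + 1) N.arcs k) := by
  -- The last cell written belongs to the top layer, the start arc and the full budget: it holds the
  -- answer.
  have hend : N.cell k (N.arcs + 1 + 1) 0 0 = N.cell k (N.arcs + 1) N.arcs k + 1 := by
    simp only [Net.cell]
    ring
  have hval : σ.bank 6 (N.cell k (N.arcs + 1) N.arcs k) = N.val (N.arcs + 1) N.arcs k := by
    rw [(h.filled _ (by omega)).1, N.flatVal_cell le_rfl le_rfl]
  obtain ⟨hr, hb', ho⟩ := execs_above (n := 10)
    (l := [.sub 21 8 1, .load 22 6 21]) (by decide) σ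
  refine (Ends.seq (Q := fun τ => LayersFilled N k (N.arcs + 1) τ ∧
    τ.reg 21 = N.cell k (N.arcs + 1) N.arcs k ∧ τ.reg 22 = N.val (N.arcs + 1) N.arcs k)
    (Ends.block (by decide) ?_) ?_).mono
    (w := 9 + ((17 + ((k + 106 + 1) * (N.arcs + 1) + 1)) + 1)) (le_of_eq (by ring)) (fun _ h => h)
  · refine ⟨⟨h.toLayerInv.congr (fun r h _ => hr r h) (fun i _ => by rw [hb']) ho, ?_, ?_⟩, ?_⟩
    · rw [hr _ (by norm_num), h.pos]
    · rw [Filled, hb']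
      exact h.filled
    · simp [execs, Instr.exec, State.setReg, h.pos, h.one, hend, hval]
  rintro τ ⟨h, h21, h22⟩
  refine Ends.ite (fun hx => ?_) fun hx => ?_
  · rw [h22] at hx
    rw [if_neg hx]
    have hloop (τ : State) (hτ : OutputInv N k (1 :: N.trace (N.arcs + 1) N.arcs k) 0 τ) :=
      Ends.loop (n := N.arcs + 1) (OutputInv N k _) (fun i σ _ h => h.left)
        (fun i σ hi h => outputStep_ends hi h) hτ
    refine (Ends.seq (Ends.block (by decide) ?_) hloop).mono le_rfl ?_
    · refine ⟨h.toHolds.congr ?_ (fun _ _ => rfl), ?_, ⟨N.arcs, k, ?_⟩, ?_⟩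
      · intro r hr
        simp [execs, Instr.exec, State.setReg, show r ≠ 9 by omega, show r ≠ 10 by omega,
          show r ≠ 14 by omega]
      · intro i hi
        exact h.filled i (by simpa [Net.cell, mul_assoc] using hi)
      · simp [execs, Instr.exec, State.setReg, h.arcs, h.width, h.one, h.out, h21, h.base]
      · simp [execs, Instr.exec, State.setReg, h.arcs_succ]
    · intro τ hτ
      obtain ⟨a, j, -, -, -, -, ho, -⟩ := hτ.rest
      simpa [Net.trace] using ho
  · rw [h22] at hx
    rw [if_pos hx]
    refine (Ends.block (by decide) ?_).mono (w := 5) (by omega) (fun _ h => h)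
    simp [execs, Instr.exec, h22, hx, h.out]

end RAM

/-! ### Building the network from the input. -/

/-- The arcs `2 * e` and `2 * e + 1` of the network are the two orientations of the edge `e` of the
graph given by the input `f`. -/
structure Net.OfEdge (f : ℕ → ℕ) (N : Net) (e : ℕ) : Prop where
  tail_even : N.tail (2 * e) = f (5 + 4 * e)
  tail_odd : N.tail (2 * e + 1) = f (5 + 4 * e + 1)
  head_even : N.head (2 * e) = f (5 + 4 * e + 1)
  head_odd : N.head (2 * e + 1) = f (5 + 4 * e)
  wt_even : N.wt (2 * e) = f (5 + 4 * e + 2) * (2 * f 1 + 1) + 1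
  wt_odd : N.wt (2 * e + 1) = f (5 + 4 * e + 2) * (2 * f 1 + 1) + 1
  col_even : N.col (2 * e) = f (5 + 4 * e + 3) + 1
  col_odd : N.col (2 * e + 1) = f (5 + 4 * e + 3) + 1
  edge_even : N.edge (2 * e) = e
  edge_odd : N.edge (2 * e + 1) = e

/-- The network of the input `f`. -/
structure Net.Of (f : ℕ → ℕ) (N : Net) : Prop where
  arcs : N.arcs = 2 * f 1
  target : N.target = f 4
  head_arcs : N.head N.arcs = f 3
  col_arcs : N.col N.arcs = 0
  edge (e : ℕ) : e < f 1 → N.OfEdge f e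

namespace RAM

def readEdge : Prog :=
  .seq (block [.load 14 0 10, .add 10 10 1, .load 15 0 10, .add 10 10 1, .load 16 0 10,
      .add 10 10 1, .load 17 0 10, .add 10 10 1, .add 17 17 1])
    (.seq (.instr (.mul 16 16 3))
      (block [.add 16 16 1, .store 1 12 14, .store 2 12 15, .store 3 12 16, .store 4 12 17,
        .store 5 12 11, .add 12 12 1, .store 1 12 15, .store 2 12 14, .store 3 12 16,
        .store 4 12 17, .store 5 12 11, .add 12 12 1, .add 11 11 1, .sub 13 13 1]))

/-- Build the network from the input. -/
def readInput : Prog :=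
  .seq (block [.const 1 1, .load 13 0 1, .const 7 2, .load 4 0 7, .add 4 4 1, .const 7 3,
      .load 8 0 7, .const 7 4, .load 5 0 7, .add 2 13 13, .add 3 2 1, .store 2 2 8,
      .const 10 5, .const 11 0, .const 12 0])
    (.seq (.instr (.mul 6 3 4)) (.loop 13 readEdge))

/-- The network that is held in the banks. -/
def netOf (f : ℕ → ℕ) (σ : State) : Net where
  arcs := 2 * f 1
  target := f 4
  tail := σ.bank 1
  head := σ.bank 2
  wt := σ.bank 3
  col := σ.bank 4
  edge := σ.bank 5

/-- The first `i` edges of the input have been read. -/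
structure ReadInv (f : ℕ → ℕ) (i : ℕ) (σ : State) : Prop where
  holds : Holds (netOf f σ) (f 2) σ
  input : σ.bank 0 = f
  values : σ.bank 6 = fun _ => 0
  succs : σ.bank 7 = fun _ => 0
  start : σ.bank 2 (2 * f 1) = f 3
  startCol : σ.bank 4 (2 * f 1) = 0
  out : σ.out = []
  pos : σ.reg 10 = 5 + 4 * i
  edgeCount : σ.reg 11 = i
  arcCount : σ.reg 12 = 2 * i
  left : σ.reg 13 = f 1 - i
  edges (e : ℕ) : e < i → (netOf f σ).OfEdge f e

theorem Net.OfEdge.congr {f : ℕ → ℕ} {σ τ : State} {e : ℕ} (h : (netOf f σ).OfEdge f e)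
    (hb : ∀ i a, a = 2 * e ∨ a = 2 * e + 1 → τ.bank i a = σ.bank i a) :
    (netOf f τ).OfEdge f e := by
  obtain ⟨h₁, h₂, h₃, h₄, h₅, h₆, h₇, h₈, h₉, h₁₀⟩ := h
  simp only [netOf] at *
  constructor <;> simpa only [hb _ _ (.inl rfl), hb _ _ (.inr rfl)]

theorem readEdge_ends {f : ℕ → ℕ} {i : ℕ} (hi : i < f 1) {σ : State} (h : ReadInv f i σ) :
    Ends readEdge σ (2 * f 1 + 100) (ReadInv f (i + 1)) := by
  refine (Ends.seq (Q := fun τ => (∀ r < 10, τ.reg r = σ.reg r) ∧ τ.bank = σ.bank ∧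
    τ.out = σ.out ∧ τ.reg 10 = 5 + 4 * (i + 1) ∧ τ.reg 11 = i ∧ τ.reg 12 = 2 * i ∧
    τ.reg 13 = f 1 - i ∧ τ.reg 14 = f (5 + 4 * i) ∧ τ.reg 15 = f (5 + 4 * i + 1) ∧
    τ.reg 16 = f (5 + 4 * i + 2) ∧ τ.reg 17 = f (5 + 4 * i + 3) + 1)
    (Ends.block (by decide) ?_) ?_).mono
    (w := 37 + ((2 * f 1 + 1 + 1) + 61)) (by omega) (fun _ h => h)
  · obtain ⟨hr, hb', ho⟩ := execs_above (n := 10) (l := [.load 14 0 10, .add 10 10 1,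
      .load 15 0 10, .add 10 10 1, .load 16 0 10, .add 10 10 1, .load 17 0 10, .add 10 10 1,
      .add 17 17 1]) (by decide) σ
    refine ⟨hr, hb', ho, ?_⟩
    simp [execs, Instr.exec, State.setReg, h.holds.one, h.input, h.pos, h.edgeCount, h.arcCount,
      h.left]
    ring
  rintro τ ⟨hr, hbank, hout, h10, h11, h12, h13, h14, h15, h16, h17⟩
  have hone : τ.reg 1 = 1 := by rw [hr _ (by norm_num), h.holds.one]
  have hthree : τ.reg 3 = 2 * f 1 + 1 := by rw [hr _ (by norm_num), h.holds.arcs_succ]; rfl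
  refine Ends.seq (Q := (· = τ.setReg 16 (f (5 + 4 * i + 2) * (2 * f 1 + 1))))
    (Ends.mul hthree.le (by rw [h16, hthree])) ?_
  rintro υ rfl
  refine Ends.block (by decide) ?_
  obtain ⟨ρ, hρ⟩ : ∃ ρ, execs [.add 16 16 1, .store 1 12 14, .store 2 12 15, .store 3 12 16,
      .store 4 12 17, .store 5 12 11, .add 12 12 1, .store 1 12 15, .store 2 12 14, .store 3 12 16,
      .store 4 12 17, .store 5 12 11, .add 12 12 1, .add 11 11 1, .sub 13 13 1]
      (τ.setReg 16 (f (5 + 4 * i + 2) * (2 * f 1 + 1))) = ρ := ⟨_, rfl⟩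
  rw [hρ]
  have hreg : ∀ r < 11, ρ.reg r = τ.reg r := by
    intro r hr
    rw [← hρ]
    simp [execs, Instr.exec, State.setReg, show r ≠ 11 by omega, show r ≠ 12 by omega,
      show r ≠ 13 by omega, show r ≠ 16 by omega]
  have hcell : ∀ j, (j = 0 ∨ 6 ≤ j) → ρ.bank j = σ.bank j := by
    intro j hj
    rw [← hρ]
    simp [execs, Instr.exec, State.setReg, hbank, show j ≠ 1 by omega, show j ≠ 2 by omega,
      show j ≠ 3 by omega, show j ≠ 4 by omega, show j ≠ 5 by omega]
  have hkeep : ∀ j a, a ≠ 2 * i → a ≠ 2 * i + 1 → ρ.bank j a = σ.bank j a := by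
    intro j a h₁ h₂
    rw [← hρ]
    simp only [execs, Instr.exec, State.setReg, hbank, Function.update_apply, h12, hone,
      Nat.reduceEqDiff, reduceIte]
    split_ifs <;> simp_all
  have hnew : (netOf f ρ).OfEdge f i := by
    rw [← hρ]
    constructor <;>
      simp [netOf, execs, Instr.exec, State.setReg, h11, h12, h14, h15, h17,
        hone]
  have hrr : ∀ r < 10, ρ.reg r = σ.reg r := fun r h => (hreg r (by omega)).trans (hr r h)
  have hH := h.holds
  refine ⟨?_, ?_, ?_, ?_, ?_, ?_, ?_, ?_, ?_, ?_, ?_, ?_⟩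
  -- `netOf` is read off the current state, so the banks agree by definition; what they contain is
  -- the business of `edges`.
  · refine ⟨?_, ?_, ?_, ?_, ?_, ?_, rfl, rfl, rfl, rfl, rfl⟩ <;> rw [hrr _ (by norm_num)]
    exacts [hH.one, hH.arcs, hH.arcs_succ, hH.width, hH.target, hH.layer]
  · rw [hcell _ (by norm_num), h.input]
  · rw [hcell _ (by norm_num), h.values]
  · rw [hcell _ (by norm_num), h.succs]
  · rw [hkeep _ _ (by omega) (by omega), h.start]
  · rw [hkeep _ _ (by omega) (by omega), h.startCol]
  · rw [← hρ]
    exact hout.trans h.out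
  · rw [hreg _ (by norm_num), h10]
  · rw [← hρ]
    simp [execs, Instr.exec, State.setReg, h11, hone]
  · rw [← hρ]
    simp [execs, Instr.exec, State.setReg, h12, hone]
    ring
  · rw [← hρ]
    simp [execs, Instr.exec, State.setReg, h13, hone]
    omega
  · intro e he
    rcases Nat.lt_succ_iff_lt_or_eq.1 he with he | rfl
    · exact Net.OfEdge.congr (h.edges e he) fun j a ha => hkeep j a (by omega) (by omega)
    · exact hnew

theorem readInput_ends {w : List ℕ} {f : ℕ → ℕ} (hf : f = fun i => w.getD i 0) :
    Ends readInput (init w) ((2 * f 1 + 101) * f 1 + f 2 + 64) (ReadInv f (f 1)) := by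
  have hloop (τ : State) (hτ : ReadInv f 0 τ) := Ends.loop (n := f 1) (ReadInv f)
    (fun i σ _ h => h.left) (fun i σ hi h => readEdge_ends hi h) hτ
  refine (Ends.seq (Q := fun τ => τ.reg 4 = f 2 + 1 ∧
      ReadInv f 0 (τ.setReg 6 (τ.reg 3 * τ.reg 4))) (Ends.block (by decide) ?_)
    fun τ hτ => Ends.seq (Ends.mul hτ.1.le hτ.2) hloop).mono
    (w := 61 + ((f 2 + 1 + 1) + ((2 * f 1 + 100 + 1) * f 1 + 1))) (le_of_eq (by ring)) (fun _ h => h)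
  have h₀ : (init w).bank 0 = f := by simp [init, hf]
  have hb : ∀ j, j ≠ 0 → (init w).bank j = fun _ => 0 := by
    intro j hj
    simp [init, hj]
  have ho : (init w).out = [] := rfl
  generalize init w = σ at *
  refine ⟨?_, ⟨⟨?_, ?_, ?_, ?_, ?_, ?_, rfl, rfl, rfl, rfl, rfl⟩,
    ?_, ?_, ?_, ?_, ?_, ?_, ?_, ?_, ?_, ?_, fun e he => absurd he (by omega)⟩⟩ <;>
    simp [execs, Instr.exec, State.setReg, netOf, h₀, hb, ho, two_mul]

/-- The program that solves the interchange-constrained shortest path problem. -/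
def solver : Prog := .seq readInput (.seq fillTables output)

theorem solver_ends {w : List ℕ} {f : ℕ → ℕ} (hf : f = fun i => w.getD i 0) :
    ∃ N : Net, N.Of f ∧ Ends solver (init w)
      (((2 * f 1 + 101) * f 1 + f 2 + 64) +
        (((((129 * (2 * f 1) + 63) * (f 2 + 1) + 28) * (2 * f 1 + 1) + 20) * (2 * f 1 + 1) + 14) +
        ((f 2 + 107) * (2 * f 1 + 1) + 28)))
      (fun τ => τ.out = if N.val (N.arcs + 1) N.arcs (f 2) = 0 then [0]
        else 1 :: N.trace (N.arcs + 1) N.arcs (f 2)) := by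
  obtain ⟨σ, hσ, h⟩ := readInput_ends hf
  refine ⟨netOf f σ, ⟨rfl, rfl, h.start, h.startCol, h.edges⟩, ?_⟩
  obtain ⟨τ, hτ, h'⟩ := (fillTables_ends h.holds h.out h.values h.succs).seq
    (fun _ hτ => output_ends hτ)
  exact ⟨τ, hσ.seq hτ, h'⟩

end RAM

/-! ### Alternations, shortcuts and the size of a connected graph. -/

namespace ColoredGraph

theorem alternations_cons_cons (a b : ℕ) (l : List ℕ) :
    alternations (a :: b :: l) = (if a = b then 0 else 1) + alternations (b :: l) := rfl

/-- The triangle inequality for the discrete metric on colors, applied to `a`, `b` and the first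
entry of `l`. -/
theorem alternations_cons_le (a b : ℕ) (l : List ℕ) :
    alternations (a :: l) ≤ (if a = b then 0 else 1) + alternations (b :: l) := by
  cases l with
  | nil => simp [alternations]
  | cons c l =>
    simp only [alternations_cons_cons]
    split_ifs <;> omega

/-- Each deleted entry is bypassed by the triangle inequality. The fixed first color is that of the
start arc in the application. -/
theorem alternations_cons_sublist {l l' : List ℕ} (h : l.Sublist l') (c : ℕ) :
    alternations (c :: l) ≤ alternations (c :: l') := by
  induction h generalizing c with
  | slnil => exact le_rfl
  | cons a _ ih =>
    rw [alternations_cons_cons c a]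
    exact (alternations_cons_le c a _).trans (Nat.add_le_add_left (ih a) _)
  | cons_cons a _ ih =>
    rw [alternations_cons_cons, alternations_cons_cons]
    exact Nat.add_le_add_left (ih a) _

theorem alternations_map {f : ℕ → ℕ} (hf : Function.Injective f) (l : List ℕ) :
    alternations (l.map f) = alternations l := by
  induction l with
  | nil => rfl
  | cons a l ih =>
    cases l with
    | nil => rfl
    | cons b l =>
      simp only [List.map_cons, alternations_cons_cons, hf.eq_iff] at ih ⊢
      rw [ih]

variable {G : ColoredGraph}

theorem IsWalk.exists_suffix {x y z : Fin G.n} {p : G.Route} (h : G.IsWalk x p y)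
    (hz : z ∈ p.map Prod.snd) : ∃ q, q.Sublist p ∧ q.length < p.length ∧ G.IsWalk z q y := by
  induction p generalizing x with
  | nil => simp at hz
  | cons a p ih =>
    obtain ⟨e, u⟩ := a
    rw [List.map_cons, List.mem_cons] at hz
    rcases hz with rfl | hz
    · exact ⟨p, List.sublist_cons_self _ _, by simp, h.2⟩
    · obtain ⟨q, h₁, h₂, h₃⟩ := ih h.2 hz
      exact ⟨q, h₁.cons _, by simp only [List.length_cons]; omega, h₃⟩

/-- A walk that is not a path can be shortcut. -/
theorem IsWalk.exists_shortcut {x y : Fin G.n} {p : G.Route} (h : G.IsWalk x p y)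
    (hp : ¬ (x :: p.map Prod.snd).Nodup) :
    ∃ q, q.Sublist p ∧ q.length < p.length ∧ G.IsWalk x q y := by
  induction p generalizing x with
  | nil => simp at hp
  | cons a p ih =>
    by_cases hx : x ∈ (a :: p).map Prod.snd
    · exact h.exists_suffix hx
    · obtain ⟨e, z⟩ := a
      obtain ⟨q, h₁, h₂, h₃⟩ := ih h.2 fun hn => hp (List.nodup_cons.2 ⟨hx, hn⟩)
      exact ⟨(e, z) :: q, h₁.cons_cons _, by simpa using h₂, h.1, h₃⟩

theorem IsPath.length_lt {x y : Fin G.n} {p : G.Route} (h : G.IsPath x p y) :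
    p.length < G.n := by
  simpa using h.2.length_le_card

/-- A connected graph has at most one node more than edges. -/
theorem Connected.card_le (h : G.Connected) : G.n ≤ G.m + 1 := by
  rcases Nat.eq_zero_or_pos G.n with h₀ | h₀
  · omega
  -- Dropping loops and merging parallel edges keeps reachability and leaves at most `m` edges, so
  -- the bound for connected simple graphs applies.
  let S : SimpleGraph (Fin G.n) := SimpleGraph.fromRel fun x y => ∃ e, G.Links e x y
  have hwalk : ∀ (p : G.Route) (x y : Fin G.n), G.IsWalk x p y → S.Reachable x y := by
    intro p
    induction p with
    | nil =>
      rintro x y rfl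
      exact SimpleGraph.Reachable.refl _
    | cons a p ih =>
      rintro x y ⟨h₁, h₂⟩
      refine SimpleGraph.Reachable.trans ?_ (ih _ _ h₂)
      by_cases hx : x = a.2
      · rw [← hx]
      · exact SimpleGraph.Adj.reachable ((SimpleGraph.fromRel_adj _ _ _).2 ⟨hx, .inl ⟨_, h₁⟩⟩)
  have hS : S.Connected :=
    { preconnected := fun x y => let ⟨p, hp⟩ := h x y; hwalk p x y hp
      nonempty := ⟨⟨0, h₀⟩⟩ }
  have hsub : S.edgeSet ⊆ Set.range fun e => s(G.fst e, G.snd e) := by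
    intro z
    induction z with
    | _ x y =>
      intro (hz : S.Adj x y)
      obtain ⟨-, ⟨e, he⟩ | ⟨e, he⟩⟩ := (SimpleGraph.fromRel_adj _ _ _).1 hz <;>
        refine ⟨e, ?_⟩ <;> rcases he with ⟨rfl, rfl⟩ | ⟨rfl, rfl⟩ <;> simp [Sym2.eq_swap]
  have h₁ := hS.card_vert_le_card_edgeSet_add_one
  have h₂ : Nat.card S.edgeSet ≤ G.m :=
    calc Nat.card S.edgeSet ≤ Nat.card (Set.range fun e => s(G.fst e, G.snd e)) :=
          Nat.card_mono (Set.finite_range _) hsub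
      _ ≤ Nat.card (Fin G.m) := Finite.card_range_le _
      _ = G.m := by simp
  rw [Nat.card_fin] at h₁
  omega

end ColoredGraph

/-! ### Correctness of the recursion. -/

namespace Net

variable {N : Net}

/-- Once an admissible arc has been seen, the current best is nonzero and can only decrease. -/
theorem scan_le {v : ℕ → ℕ → ℕ} {a j n b : ℕ} (hb : b < n) (h₁ : N.tail b = N.head a)
    (h₂ : N.turn a b ≤ j) (h₃ : v b (j - N.turn a b) ≠ 0) :
    (N.scan v a j n).1 ≠ 0 ∧ (N.scan v a j n).1 ≤ v b (j - N.turn a b) + N.wt b := by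
  induction n with
  | zero => omega
  | succ n ih =>
    rw [scan, relax]
    rcases Nat.lt_succ_iff_lt_or_eq.1 hb with hb | rfl
    · have := ih hb
      split_ifs with h
      · exact ⟨by simp only; omega, by simp only; omega⟩
      · exact this
    · split_ifs with h
      · exact ⟨by simp only; omega, le_rfl⟩
      · by_contra hc
        exact h ⟨h₁, h₂, h₃, by omega⟩

theorem scan_spec {v : ℕ → ℕ → ℕ} {a j n : ℕ} (h : (N.scan v a j n).1 ≠ 0) :
    ∃ b < n, (N.scan v a j n).2 = b ∧ N.tail b = N.head a ∧ N.turn a b ≤ j ∧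
      v b (j - N.turn a b) ≠ 0 ∧ (N.scan v a j n).1 = v b (j - N.turn a b) + N.wt b := by
  induction n with
  | zero => simp [scan] at h
  | succ n ih =>
    rw [scan, relax] at h ⊢
    split_ifs at h ⊢ with hc
    · exact ⟨n, by omega, rfl, hc.1, hc.2.1, hc.2.2.1, rfl⟩
    · obtain ⟨b, hb, hb'⟩ := ih h
      exact ⟨b, by omega, hb'⟩

/-- The arc `b` is the edge `e` of `G`, directed from `x` to `y`. -/
structure IsArc (N : Net) (G : ColoredGraph) (b : ℕ) (e : Fin G.m) (x y : Fin G.n) : Prop where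
  lt : b < N.arcs
  links : G.Links e x y
  tail : N.tail b = x
  head : N.head b = y
  wt : N.wt b = G.len e * (N.arcs + 1) + 1
  col : N.col b = G.col e + 1
  edge : N.edge b = e

/-- The arcs of the network are the directed edges of `G`. -/
structure Represents (N : Net) (G : ColoredGraph) (s t : Fin G.n) : Prop where
  arcs : N.arcs = 2 * G.m
  target : N.target = t
  head_arcs : N.head N.arcs = s
  col_arcs : N.col N.arcs = 0
  exists_link {b : ℕ} : b < N.arcs → ∃ e x y, N.IsArc G b e x y
  exists_arc {e : Fin G.m} {x y : Fin G.n} : G.Links e x y → ∃ b, N.IsArc G b e x y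

/-- The colors of a route as the network has them. -/
def colors {G : ColoredGraph} (p : G.Route) : List ℕ := p.map fun a => G.col a.1 + 1

/-- The weight of a route: its length comes first, its number of edges second. -/
def weight (N : Net) {G : ColoredGraph} (p : G.Route) : ℕ :=
  (p.map fun a => G.len a.1 * (N.arcs + 1) + 1).sum

theorem weight_eq {G : ColoredGraph} (p : G.Route) :
    N.weight p = G.routeLength p * (N.arcs + 1) + p.length := by
  induction p with
  | nil => simp [weight, ColoredGraph.routeLength]
  | cons a p ih =>
    simp only [weight, ColoredGraph.routeLength, List.map_cons, List.sum_cons,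
      List.length_cons] at ih ⊢
    rw [ih]
    ring

theorem weight_lt_of_sublist {G : ColoredGraph} {p q : G.Route} (h : q.Sublist p)
    (hl : q.length < p.length) : N.weight q < N.weight p := by
  have : G.routeLength q ≤ G.routeLength p := (h.map _).sum_le_sum fun _ _ => Nat.zero_le _
  rw [weight_eq, weight_eq]
  exact add_lt_add_of_le_of_lt (Nat.mul_le_mul_right _ this) hl

open ColoredGraph

/-- No shifted color is 0, so a nonempty route has exactly one additional alternation at the start.
For the empty route both sides hold. -/
theorem alternations_colors {G : ColoredGraph} {k : ℕ} (hk : 1 ≤ k) (p : G.Route) :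
    alternations (0 :: colors p) ≤ k ↔ alternations (G.colors p) ≤ k - 1 := by
  have h : alternations (colors p) = alternations (G.colors p) := by
    rw [← alternations_map (f := (· + 1)) (fun _ _ => Nat.succ.inj) (G.colors p)]
    simp [colors, ColoredGraph.colors, Function.comp_def]
  cases p with
  | nil => simp [colors, ColoredGraph.colors, alternations]
  | cons a p =>
    rw [← h]
    simp only [colors, List.map_cons, alternations_cons_cons]
    rw [if_neg (by omega)]
    omega

variable {G : ColoredGraph} {s t : Fin G.n}

/-- Optimality, by induction on the walk: its first edge is an arc that the scan has tried, and the
rest is a walk for the layer below with the remaining budget. -/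
theorem Represents.val_le (h : N.Represents G s t) {p : G.Route} {x : Fin G.n} {L a j : ℕ}
    (hx : N.head a = x) (hp : G.IsWalk x p t) (hj : alternations (N.col a :: colors p) ≤ j)
    (hL : p.length < L) : N.val L a j ≠ 0 ∧ N.val L a j ≤ N.weight p + 1 := by
  induction p generalizing x L a j with
  | nil =>
    obtain ⟨L, rfl⟩ : ∃ M, L = M + 1 := ⟨L - 1, by simp at hL; omega⟩
    rw [val, if_pos (by rw [hx, h.target, show x = t from hp])]
    simp
  | cons q p ih =>
    obtain ⟨e, z⟩ := q
    obtain ⟨L, rfl⟩ : ∃ M, L = M + 1 := ⟨L - 1, by simp at hL; omega⟩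
    rw [val]
    split_ifs with ht
    · simp
    obtain ⟨b, hb⟩ := h.exists_arc hp.1
    have hturn : alternations (N.col a :: colors ((e, z) :: p)) =
        N.turn a b + alternations (N.col b :: colors p) := by
      simp only [colors, List.map_cons, alternations_cons_cons, turn, hb.col]
    rw [hturn] at hj
    obtain ⟨h₁, h₂⟩ := ih (L := L) (a := b) (j := j - N.turn a b) hb.head hp.2 (by omega)
      (by simpa using hL)
    obtain ⟨h₃, h₄⟩ := scan_le (N := N) (v := N.val L) hb.lt (hb.tail.trans hx.symm)
      (show N.turn a b ≤ j by omega) h₁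
    refine ⟨h₃, h₄.trans ?_⟩
    have : N.weight ((e, z) :: p) = N.wt b + N.weight p := by simp [weight, hb.wt]
    omega

/-- Attainment, by induction on the layer: prepend the arc chosen by the scan to the walk found for
it. The same choice drives `trace`, so the output lists this very walk. -/
theorem Represents.exists_walk (h : N.Represents G s t) {x : Fin G.n} {L a j : ℕ}
    (hx : N.head a = x) (hv : N.val L a j ≠ 0) :
    ∃ p : G.Route, G.IsWalk x p t ∧ alternations (N.col a :: colors p) ≤ j ∧ p.length < L ∧
      N.val L a j = N.weight p + 1 ∧
      N.trace L a j = p.flatMap fun q => [(q.1 : ℕ), (q.2 : ℕ)] := by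
  induction L generalizing x a j with
  | zero => simp [val] at hv
  | succ L ih =>
    rw [val] at hv ⊢
    rw [trace]
    split_ifs at hv ⊢ with ht
    · refine ⟨[], ?_, by simp [colors, alternations], by simp, by simp [weight], rfl⟩
      rw [hx, h.target] at ht
      exact Fin.ext ht
    · obtain ⟨b, hb, hs, h₁, h₂, h₃, h₄⟩ := scan_spec hv
      obtain ⟨e, y, z, harc⟩ := h.exists_link hb
      obtain rfl : y = x := Fin.ext (by rw [← hx, ← h₁, harc.tail])
      obtain ⟨p, hp₁, hp₂, hp₃, hp₄, hp₅⟩ := ih harc.head h₃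
      refine ⟨(e, z) :: p, ⟨harc.links, hp₁⟩, ?_, by simpa using hp₃, ?_, ?_⟩
      · have hturn : alternations (N.col a :: colors ((e, z) :: p)) =
            N.turn a b + alternations (N.col b :: colors p) := by
          simp only [colors, List.map_cons, alternations_cons_cons, turn, harc.col]
        omega
      · have : N.weight ((e, z) :: p) = N.wt b + N.weight p := by simp [weight, harc.wt]
        omega
      · have hsucc : N.succ (L + 1) a j = b := hs
        rw [hsucc, hp₅, harc.edge, harc.head]
        rfl

end Net

theorem List.getD_flatMap_four {α : Type*} (l : List α) (g : α → List ℕ)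
    (hg : ∀ a, (g a).length = 4) {i j : ℕ} (hi : i < l.length) (hj : j < 4) :
    (l.flatMap g).getD (4 * i + j) 0 = (g l[i]).getD j 0 := by
  induction l generalizing i with
  | nil => simp at hi
  | cons a l ih =>
    rw [List.flatMap_cons]
    cases i with
    | zero => rw [List.getD_append _ _ _ _ (by rw [hg]; omega)]; simp
    | succ i =>
      rw [List.getD_append_right _ _ _ _ (by rw [hg]; omega), hg,
        show 4 * (i + 1) + j - 4 = 4 * i + j by omega, ih (by simpa using hi)]
      rfl

/-! ### From encoded instances to correct answers. -/

namespace PIInstance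

variable (I : PIInstance)

theorem encode_edge (e : Fin I.m) {j : ℕ} (hj : j < 4) :
    I.encode.getD (5 + 4 * e + j) 0 =
      [(I.fst e : ℕ), (I.snd e : ℕ), I.len e, I.col e].getD j 0 := by
  rw [encode, List.getD_append_right _ _ _ _ (by simp; omega),
    show 5 + 4 * (e : ℕ) + j - [I.n, I.m, I.k, (I.s : ℕ), (I.t : ℕ)].length = 4 * e + j by
      simp only [List.length_cons, List.length_nil]; omega,
    List.getD_flatMap_four _ _ (fun _ => rfl) (by simp) hj]
  simp

theorem length_encode : I.encode.length = 5 + 4 * I.m := by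
  simp [encode, List.length_flatMap]
  omega

theorem represents {N : Net} (h : N.Of fun i => I.encode.getD i 0) :
    N.Represents I.toColoredGraph I.s I.t := by
  have hm : I.encode.getD 1 0 = I.m := rfl
  have harcs := h.arcs
  simp only [hm] at harcs
  have key (e : Fin I.m) : N.IsArc I.toColoredGraph (2 * e) e (I.fst e) (I.snd e) ∧
      N.IsArc I.toColoredGraph (2 * e + 1) e (I.snd e) (I.fst e) := by
    obtain ⟨h₁, h₂, h₃, h₄, h₅, h₆, h₇, h₈, h₉, h₁₀⟩ := h.edge e e.2
    have e₀ : I.encode.getD (5 + 4 * e) 0 = I.fst e := I.encode_edge e (j := 0) (by norm_num)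
    have e₁ := I.encode_edge e (j := 1) (by norm_num)
    have e₂ := I.encode_edge e (j := 2) (by norm_num)
    have e₃ := I.encode_edge e (j := 3) (by norm_num)
    simp only [e₀, e₁, e₂, e₃, hm] at h₁ h₂ h₃ h₄ h₅ h₆ h₇ h₈
    rw [← harcs] at h₅ h₆
    exact ⟨⟨by omega, .inl ⟨rfl, rfl⟩, h₁, h₃, h₅, h₇, h₉⟩,
      ⟨by omega, .inr ⟨rfl, rfl⟩, h₂, h₄, h₆, h₈, h₁₀⟩⟩
  refine ⟨harcs, h.target, h.head_arcs, h.col_arcs, ?_, ?_⟩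
  · intro b hb
    have he : b / 2 < I.m := by omega
    rcases Nat.mod_two_eq_zero_or_one b with hb' | hb'
    · have := (key ⟨b / 2, he⟩).1
      rw [show 2 * ((⟨b / 2, he⟩ : Fin I.m) : ℕ) = b by simp only; omega] at this
      exact ⟨_, _, _, this⟩
    · have := (key ⟨b / 2, he⟩).2
      rw [show 2 * ((⟨b / 2, he⟩ : Fin I.m) : ℕ) + 1 = b by simp only; omega] at this
      exact ⟨_, _, _, this⟩
  · rintro e x y (⟨rfl, rfl⟩ | ⟨rfl, rfl⟩)
    exacts [⟨_, (key e).1⟩, ⟨_, (key e).2⟩]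

variable {I}

/-- The output computed from the network is a correct answer. -/
theorem exists_answer {N : Net} (h : N.Represents I.toColoredGraph I.s I.t) :
    ∃ b : I.Answer, (if N.val (N.arcs + 1) N.arcs I.k = 0 then [0]
      else 1 :: N.trace (N.arcs + 1) N.arcs I.k) = I.encodeAnswer b ∧ I.IsSolution b := by
  have hn : I.n ≤ N.arcs + 1 := by
    have := I.connected.card_le
    have := h.arcs
    omega
  have hle {q : I.Route} (hq : I.IsWalk I.s q I.t) (hl : q.length < N.arcs + 1)
      (hk : ColoredGraph.alternations (0 :: Net.colors q) ≤ I.k) :=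
    h.val_le (j := I.k) h.head_arcs hq (by rwa [h.col_arcs]) hl
  split_ifs with hv
  · refine ⟨none, rfl, ?_⟩
    rintro ⟨q, hq, hk⟩
    exact (hle hq.1 (hq.length_lt.trans_le hn) ((Net.alternations_colors I.one_le_k q).2 hk)).1 hv
  · obtain ⟨p, hp, hk, hl, hw, htr⟩ := h.exists_walk h.head_arcs hv
    rw [h.col_arcs] at hk
    refine ⟨some p, by rw [htr]; rfl, ⟨⟨hp, ?_⟩, (Net.alternations_colors I.one_le_k p).1 hk⟩, ?_⟩
    -- A shortcut would be feasible and strictly lighter, against minimality.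
    · by_contra hnd
      obtain ⟨q, hs, hlt, hq⟩ := hp.exists_shortcut hnd
      have h₁ := (hle hq (hlt.trans hl)
        ((ColoredGraph.alternations_cons_sublist (hs.map _) 0).trans hk)).2
      have h₂ := Net.weight_lt_of_sublist (N := N) hs hlt
      omega
    · rintro q ⟨hq, hqk⟩
      have hql := hq.length_lt.trans_le hn
      have h₁ := (hle hq.1 hql ((Net.alternations_colors I.one_le_k q).2 hqk)).2
      rw [hw, Net.weight_eq, Net.weight_eq] at h₁
      -- One extra unit of length costs `arcs + 1`, more than the at most `arcs` edges of `q` can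
      -- make up for.
      by_contra hc
      have : (I.routeLength q + 1) * (N.arcs + 1) ≤ I.routeLength p * (N.arcs + 1) :=
        Nat.mul_le_mul_right _ (by omega)
      rw [add_mul, one_mul] at this
      omega

end PIInstance

/-! ### The polynomial bound. -/

namespace RAM

theorem length_le_bitSize (w : List ℕ) : w.length ≤ bitSize w := by
  induction w with
  | nil => simp [bitSize]
  | cons a w ih =>
    simp only [bitSize, List.map_cons, List.sum_cons, List.length_cons] at ih ⊢
    omega

theorem size_getD_le_bitSize (w : List ℕ) (i : ℕ) : (w.getD i 0).size ≤ bitSize w := by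
  by_cases hi : i < w.length
  · rw [List.getD_eq_getElem _ _ hi]
    have : (w[i]).size + 1 ∈ w.map fun a => a.size + 1 :=
      List.mem_map.2 ⟨_, List.getElem_mem hi, rfl⟩
    exact (Nat.le_succ _).trans (List.le_sum_of_mem this)
  · rw [List.getD_eq_default _ _ (by omega)]
    simp

theorem init_bounded (w : List ℕ) : (init w).Bounded (bitSize w) := by
  refine ⟨fun r => ?_, fun i j => ?_⟩
  · simp only [init, Function.update_apply]
    split_ifs
    · exact (Nat.size_le.2 Nat.lt_two_pow_self).trans (length_le_bitSize w)
    · simp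
  · simp only [init, Function.update_apply]
    split_ifs
    · exact size_getD_le_bitSize w j
    · simp

/-- Weight of a run of the solver on an input of size `X`. -/
noncomputable def weightBound : Polynomial ℕ :=
  ((2 * .X + 101) * .X + .X + 64) +
    (((((129 * (2 * .X) + 63) * (.X + 1) + 28) * (2 * .X + 1) + 20) * (2 * .X + 1) + 14) +
    ((.X + 107) * (2 * .X + 1) + 28))

end RAM

theorem proposition2 :
    RAM.SolvableInPolyTime PIInstance.encode PIInstance.encodeAnswer PIInstance.IsSolution := by
  -- This is the cost bound in `Reach`, with the bit size both as the initial bound on digits and as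
  -- the argument of the weight.
  refine ⟨RAM.solver, RAM.weightBound * (1 + 2 * (.X + RAM.weightBound)), fun I => ?_⟩
  obtain ⟨N, hN, τ, ⟨c, hrun, hc⟩, hout⟩ := RAM.solver_ends (w := I.encode) rfl
  obtain ⟨b, hb, hsol⟩ := PIInstance.exists_answer (I.represents hN)
  refine ⟨b, c, τ, hrun, hout.trans hb, hsol, (hc _ (RAM.init_bounded _)).2.trans ?_⟩
  have hlen := RAM.length_le_bitSize I.encode
  rw [I.length_encode] at hlen
  -- The weight involves the value of `k`, not its number of digits; connectivity bounds this value
  -- by the number of input entries.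
  have hk : I.k ≤ RAM.bitSize I.encode := by
    have := I.connected.card_le
    have := I.k_le
    omega
  have hm : I.m ≤ RAM.bitSize I.encode := by omega
  have h₁ : I.encode.getD 1 0 = I.m := rfl
  have h₂ : I.encode.getD 2 0 = I.k := rfl
  simp only [h₁, h₂, RAM.weightBound, Polynomial.eval_mul, Polynomial.eval_add, Polynomial.eval_X,
    Polynomial.eval_one, Polynomial.eval_ofNat]
  gcongr
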